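/- Let $n\ge 0$ be an integer, let $p,q,c$ be real numbers with $c\ge 0$, and put $V(x)=c\,|x|_q^{\,p}$ for $x\in\mathbb R^n$, where $|x|_q=\bigl(\sum_{i=1}^n|x_i|^q\bigr)^{1/q}$. For a function $\Phi:\mathbb R^n\to(-\infty,+\infty]$ that is not identically $+\infty$ (a proper function; convexity is not required) let $\Phi^*(y)=\sup_{x\in\mathbb R^n}\bigl(\langle x,y\rangle-\Phi(x)\bigr)$ be its Legendre transform. Consider the generalized Blaschke--Santaló inequality $$\int_{\mathbb R^n} e^{-\Phi(x)}\,dx\;\Bigl(\int_{\mathbb R^n} e^{-\frac1{p-1}\Phi^*(\nabla V(y))}\,dy\Bigr)^{p-1}\le\Bigl(\int_{\mathbb R^n} e^{-V(x)}\,dx\Bigr)^{p},$$ in which the integrals take values in $[0,\infty]$, with $e^{-\infty}=0$ and $0\cdot\infty=0$. 1. If $p\ge q>1$, the inequality holds for every proper unconditional $\Phi$, that is, every proper $\Phi$ with $\Phi(\pm x_1,\dots,\pm x_n)=\Phi(x_1,\dots,x_n)$ for all $x$ and all choices of signs. 2. If $p\ge q\ge 2$, the inequality holds for every proper even $\Phi$,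 that is, every proper $\Phi$ with $\Phi(-x)=\Phi(x)$ for all $x$. -/

import Mathlib

open MeasureTheory
open scoped ENNReal

noncomputable section

namespace BlaschkeSantalo

/-- A function with values in `(-∞, +∞]` that is not identically `+∞`. -/
def IsProper {n : ℕ} (Φ : EuclideanSpace ℝ (Fin n) → EReal) : Prop :=
  (∀ x, Φ x ≠ ⊥) ∧ ∃ x, Φ x ≠ ⊤

/-- `Φ (±x₁, …, ±xₙ) = Φ (x₁, …, xₙ)` for every choice of signs. -/
def IsUnconditional {n : ℕ} (Φ : EuclideanSpace ℝ (Fin n) → EReal) : Prop :=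
  ∀ ε : Fin n → ℝ, (∀ i, ε i = 1 ∨ ε i = -1) →
    ∀ x : EuclideanSpace ℝ (Fin n), Φ (WithLp.toLp 2 fun i => ε i * x i) = Φ x

/-- The Legendre transform `Φ^*(y) = sup_x (⟨x, y⟩ - Φ(x))`. -/
def legendre {n : ℕ} (Φ : EuclideanSpace ℝ (Fin n) → EReal)
    (y : EuclideanSpace ℝ (Fin n)) : EReal :=
  ⨆ x : EuclideanSpace ℝ (Fin n), ((inner ℝ x y : ℝ) : EReal) - Φ x

/-- The `l^q`-norm `|x|_q = (∑ |x_i|^q)^{1/q}`. -/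
def lqNorm {n : ℕ} (q : ℝ) (x : EuclideanSpace ℝ (Fin n)) : ℝ :=
  (∑ i, |x i| ^ q) ^ (1 / q)

/-- The inequality `∫ e^{-Φ} dx · (∫ e^{-Φ^*(∇V(y))/(p-1)} dy)^{p-1} ≤ (∫ e^{-V} dx)^p`.
The integrals are `[0, ∞]`-valued, with `e^{-∞} = 0` and `0 · ∞ = 0`. -/
def GeneralizedBS {n : ℕ} (p : ℝ) (V : EuclideanSpace ℝ (Fin n) → ℝ)
    (Φ : EuclideanSpace ℝ (Fin n) → EReal) : Prop :=
  (∫⁻ x, EReal.exp (-Φ x)) *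
      (∫⁻ y, EReal.exp (-(((1 / (p - 1) : ℝ) : EReal) * legendre Φ (gradient V y)))) ^ (p - 1)
    ≤ (∫⁻ x, ENNReal.ofReal (Real.exp (-V x))) ^ p

end BlaschkeSantalo

end

/-! Put F = e^{-Φ} and G = e^{-Φ*}. The definition of the Legendre transform says exactly that F(x)
G(u) ≤ e^{-⟨x,u⟩}, and this polarity is the only relation between F and G that the proof uses.

Unconditional case. On the positive orthant the substitution x = e^u turns Prékopa–Leindler into a
multiplicative form, in which arithmetic means are replaced by coordinatewise geometric means
(`hasPrekopaLeindler_abs`). It is applied with exponents 1/p and (p-1)/p to F and to y ↦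
G(∇V(y))^{1/(p-1)}. By polarity the product of the powers is at most e^{-⟨x,∇V(y)⟩/p}. Hölder's
inequality, available because p ≥ q, gives V(x^{1/p} y^{(p-1)/p}) ≤ ⟨x,∇V(y)⟩/p
(`potential_geom_mean_le`), so this is at most e^{-V} at the geometric mean. Raising the conclusion
to the power p gives the claim (`santalo_unconditional`).

Even case. An even polar pair is made unconditional without decreasing either integral. For each
coordinate i, F is symmetrized in the coordinate i and G in all the others. Prékopa–Leindler with
exponents 1/2 shows that the integral of F does not decrease, and the cross terms in the exponents
cancel, so polarity survives (`IsPolarPair.symm`). For G, the change of variables u = ∇V(y) produces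
a weight: a negative power of |u|_{q/(q-1)} times powers of the |u_i|. For p ≥ q ≥ 2 every factor is
invariant under reflections and quasi-concave, so a layer-cake argument extends the symmetrization
inequality to the weighted integral (`SymmDominates.lintegral_mul_prod_le`).

Since Φ is arbitrary, F and G need not be measurable. They are first replaced by lower
semicontinuous majorants on large balls, polar up to a constant that tends to 1
(`le_of_forall_lowerSemicontinuous`). -/

noncomputable section

namespace BlaschkeSantalo

open Set Filter Topology
open scoped Pointwise

/-! ### The Prékopa–Leindler inequality -/

/-- One-dimensional Brunn–Minkowski for compact sets. -/
theorem volume_add_le_of_isCompact {K L C : Set ℝ} (hK : IsCompact K) (hL : IsCompact L)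
    (hK0 : K.Nonempty) (hL0 : L.Nonempty) (hC : ∀ x ∈ K, ∀ y ∈ L, x + y ∈ C) :
    volume K + volume L ≤ volume C := by
  obtain ⟨a, ha⟩ := hK.exists_isGreatest hK0
  obtain ⟨b, hb⟩ := hL.exists_isLeast hL0
  have h1 : volume ((fun x => x + b) '' K) = volume K := by
    rw [image_add_right, measure_preimage_add_right]
  have h2 : volume ((fun y => a + y) '' L) = volume L := by
    rw [image_add_left, measure_preimage_add]
  -- With a = max K and b = min L, the translates K + b and a + L lie on opposite sides of a + b and
  -- can share only that point.
  have hd : AEDisjoint volume ((fun x => x + b) '' K) ((fun y => a + y) '' L) := by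
    refine measure_mono_null (t := {a + b}) ?_ (by simp)
    rintro _ ⟨⟨x, hx, rfl⟩, ⟨y, hy, hxy⟩⟩
    have := ha.2 hx
    have := hb.2 hy
    simp only [mem_singleton_iff] at *
    linarith
  rw [← h1, ← h2, ← measure_union₀ _ hd]
  · refine measure_mono (union_subset ?_ ?_)
    · rintro _ ⟨x, hx, rfl⟩; exact hC x hx b hb.1
    · rintro _ ⟨y, hy, rfl⟩; exact hC a ha.1 y hy
  · exact ((hL.image (continuous_const.add continuous_id)).measurableSet).nullMeasurableSet

theorem volume_add_le {A B C : Set ℝ} (hA : MeasurableSet A) (hB : MeasurableSet B)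
    (hA0 : A.Nonempty) (hB0 : B.Nonempty) (hC : ∀ x ∈ A, ∀ y ∈ B, x + y ∈ C) :
    volume A + volume B ≤ volume C := by
  obtain ⟨a, ha⟩ := hA0
  obtain ⟨b, hb⟩ := hB0
  rw [hA.measure_eq_iSup_isCompact, hB.measure_eq_iSup_isCompact]
  simp_rw [iSup_and']
  refine ENNReal.biSup_add_biSup_le' ⟨{a}, by simp [ha]⟩ ⟨{b}, by simp [hb]⟩ ?_
  rintro K ⟨hKA, hK⟩ L ⟨hLB, hL⟩
  -- The approximating compact sets may be empty; adjoining a and b makes them nonempty inside A and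
  -- B.
  refine (add_le_add (measure_mono (subset_insert a K)) (measure_mono (subset_insert b L))).trans ?_
  refine volume_add_le_of_isCompact (hK.insert a) (hL.insert b) (insert_nonempty _ _)
    (insert_nonempty _ _) fun x hx y hy => hC x ?_ y ?_
  · exact insert_subset ha hKA hx
  · exact insert_subset hb hLB hy

/-- Layer cake for `[0, ∞]`-valued functions. -/
theorem volume_lt_eq (a : ℝ≥0∞) : volume {t : ℝ | 0 < t ∧ ENNReal.ofReal t < a} = a := by
  rcases eq_or_ne a ∞ with rfl | ha
  · have : {t : ℝ | 0 < t ∧ ENNReal.ofReal t < ∞} = Ioi 0 := by ext; simp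
    rw [this, Real.volume_Ioi]
  · have : {t : ℝ | 0 < t ∧ ENNReal.ofReal t < a} = Ioo 0 a.toReal := by
      ext t
      simp only [mem_ofPred_eq, mem_Ioo]
      exact and_congr_right fun ht => by
        rw [ENNReal.ofReal_lt_iff_lt_toReal ht.le ha]
    rw [this, Real.volume_Ioo, sub_zero, ENNReal.ofReal_toReal ha]

theorem lintegral_mul_eq_lintegral_lt {X : Type*} [MeasurableSpace X] {μ : Measure X} [SFinite μ]
    {F w : X → ℝ≥0∞} (hF : Measurable F) (hw : Measurable w) :
    ∫⁻ x, F x * w x ∂μ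
      = ∫⁻ t in Ioi (0 : ℝ), ∫⁻ x, {x | ENNReal.ofReal t < w x}.indicator F x ∂μ := by
  have hm : MeasurableSet {z : X × ℝ | ENNReal.ofReal z.2 < w z.1} :=
    measurableSet_lt (by fun_prop) (by fun_prop)
  have hind : Measurable fun z : X × ℝ => {z : X × ℝ | ENNReal.ofReal z.2 < w z.1}.indicator
      (fun z => F z.1) z := (hF.comp measurable_fst).indicator hm
  have : ∀ x, F x * w x = ∫⁻ t in Ioi (0 : ℝ), {x | ENNReal.ofReal t < w x}.indicator F x := by
    intro x
    have h1 : ∀ t : ℝ, {x | ENNReal.ofReal t < w x}.indicator F x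
        = {t : ℝ | ENNReal.ofReal t < w x}.indicator (fun _ => F x) t := fun t => by
      simp [indicator]
    simp_rw [h1]
    have h2 : MeasurableSet {t : ℝ | ENNReal.ofReal t < w x} :=
      measurableSet_lt (by fun_prop) (by fun_prop)
    rw [lintegral_indicator h2, setLIntegral_const, Measure.restrict_apply h2]
    conv_lhs => rw [← volume_lt_eq (w x)]
    congr 2
    ext t; simp [and_comm]
  simp_rw [this]
  rw [lintegral_lintegral_swap]
  exact hind.aemeasurable

theorem lintegral_eq_lintegral_lt {X : Type*} [MeasurableSpace X] {μ : Measure X} [SFinite μ]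
    {w : X → ℝ≥0∞} (hw : Measurable w) :
    ∫⁻ x, w x ∂μ = ∫⁻ t in Ioi (0 : ℝ), μ {x | ENNReal.ofReal t < w x} := by
  have := lintegral_mul_eq_lintegral_lt (μ := μ) (F := fun _ => 1) measurable_const hw
  simp only [one_mul] at this
  rw [this]
  refine lintegral_congr fun t => ?_
  rw [lintegral_indicator (measurableSet_lt (by fun_prop) hw)]
  simp


theorem ENNReal_geom_mean_le_arith_mean {s t : ℝ} (hs : 0 < s) (ht : 0 < t) (hst : s + t = 1)
    (a b : ℝ≥0∞) : a ^ s * b ^ t ≤ ENNReal.ofReal s * a + ENNReal.ofReal t * b := by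
  have hc : (s⁻¹).HolderConjugate t⁻¹ := by
    rw [Real.holderConjugate_iff]
    refine ⟨(one_lt_inv₀ hs).2 (by linarith), by simpa using hst⟩
  have h := ENNReal.young_inequality (a ^ s) (b ^ t) hc
  rw [← ENNReal.rpow_mul, ← ENNReal.rpow_mul, mul_inv_cancel₀ hs.ne', mul_inv_cancel₀ ht.ne',
    ENNReal.rpow_one, ENNReal.rpow_one, ENNReal.ofReal_inv_of_pos hs,
    ENNReal.ofReal_inv_of_pos ht, div_eq_mul_inv, div_eq_mul_inv, inv_inv, inv_inv] at h
  simpa [mul_comm] using h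

theorem volume_smul_add_smul_le {s t : ℝ} (hs : 0 < s) (ht : 0 < t) {A B C : Set ℝ}
    (hA : MeasurableSet A) (hB : MeasurableSet B) (hA0 : A.Nonempty) (hB0 : B.Nonempty)
    (hC : ∀ x ∈ A, ∀ y ∈ B, s * x + t * y ∈ C) :
    ENNReal.ofReal s * volume A + ENNReal.ofReal t * volume B ≤ volume C := by
  have h : ∀ {r : ℝ}, 0 < r → ∀ S : Set ℝ, volume (r • S) = ENNReal.ofReal r * volume S := by
    intro r hr S
    rw [Measure.addHaar_smul]
    simp [abs_of_pos hr]
  rw [← h hs, ← h ht]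
  refine volume_add_le (hA.const_smul₀ s) (hB.const_smul₀ t) (hA0.smul_set) (hB0.smul_set) ?_
  rintro _ ⟨x, hx, rfl⟩ _ ⟨y, hy, rfl⟩
  simpa using hC x hx y hy

/-- With both suprema equal to 1, the superlevel sets of f and g are nonempty for the same levels,
those below 1. Brunn–Minkowski then applies level by level, and the layer-cake formula integrates
the result. -/
theorem lintegral_add_le_of_iSup_eq_one {s t : ℝ} (hs : 0 < s) (ht : 0 < t) (hst : s + t = 1)
    {f g h : ℝ → ℝ≥0∞} (hf : Measurable f) (hg : Measurable g) (hh : Measurable h)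
    (hf1 : ⨆ x, f x = 1) (hg1 : ⨆ x, g x = 1)
    (H : ∀ x y, f x ^ s * g y ^ t ≤ h (s * x + t * y)) :
    ENNReal.ofReal s * (∫⁻ x, f x) + ENNReal.ofReal t * (∫⁻ x, g x) ≤ ∫⁻ x, h x := by
  have key : ∀ r : ℝ, 0 < r → ENNReal.ofReal s * volume {x | ENNReal.ofReal r < f x} +
      ENNReal.ofReal t * volume {x | ENNReal.ofReal r < g x}
        ≤ volume {x | ENNReal.ofReal r < h x} := by
    intro r hr
    by_cases hr1 : ENNReal.ofReal r < 1
    · refine volume_smul_add_smul_le hs ht (measurableSet_lt measurable_const hf)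
        (measurableSet_lt measurable_const hg) ?_ ?_ ?_
      · obtain ⟨x, hx⟩ := lt_iSup_iff.1 (hf1.symm ▸ hr1)
        exact ⟨x, hx⟩
      · obtain ⟨x, hx⟩ := lt_iSup_iff.1 (hg1.symm ▸ hr1)
        exact ⟨x, hx⟩
      intro x hx y hy
      refine lt_of_lt_of_le ?_ (H x y)
      calc ENNReal.ofReal r = ENNReal.ofReal r ^ s * ENNReal.ofReal r ^ t := by
            rw [← ENNReal.rpow_add _ _ (by simpa using hr) (by simp), hst, ENNReal.rpow_one]
        _ < _ := ENNReal.mul_lt_mul (ENNReal.rpow_lt_rpow hx hs) (ENNReal.rpow_lt_rpow hy ht)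
    · have h1 : {x | ENNReal.ofReal r < f x} = ∅ := by
        ext x
        simpa using (hf1 ▸ le_iSup f x).trans (not_lt.1 hr1)
      have h2 : {x | ENNReal.ofReal r < g x} = ∅ := by
        ext x
        simpa using (hg1 ▸ le_iSup g x).trans (not_lt.1 hr1)
      simp [h1, h2]
  rw [lintegral_eq_lintegral_lt hf, lintegral_eq_lintegral_lt hg, lintegral_eq_lintegral_lt hh,
    ← lintegral_const_mul' _ _ (by simp), ← lintegral_const_mul' _ _ (by simp),
    ← lintegral_add_left']
  · exact setLIntegral_mono' measurableSet_Ioi key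
  · refine (Measurable.const_mul ?_ _).aemeasurable
    refine Antitone.measurable fun a b hab => measure_mono fun x hx => ?_
    exact (ENNReal.ofReal_le_ofReal hab).trans_lt hx

/-- `μ` satisfies the Prékopa–Leindler inequality with exponents `s`, `t` for the mean `m`. -/
def HasPrekopaLeindler {X : Type*} [MeasurableSpace X] (μ : Measure X) (m : X → X → X)
    (s t : ℝ) : Prop :=
  ∀ f g h : X → ℝ≥0∞, Measurable f → Measurable g → Measurable h →
    (∀ x y, f x ^ s * g y ^ t ≤ h (m x y)) →
      (∫⁻ x, f x ∂μ) ^ s * (∫⁻ x, g x ∂μ) ^ t ≤ ∫⁻ x, h x ∂μ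

/-- Dividing f and g by their suprema reduces to the normalized case, where the arithmetic-geometric
mean inequality turns the additive bound into the multiplicative one. The normalizing factors cancel
by homogeneity. -/
theorem lintegral_rpow_mul_le_of_bounded {s t : ℝ} (hs : 0 < s) (ht : 0 < t) (hst : s + t = 1)
    {f g h : ℝ → ℝ≥0∞} (hf : Measurable f) (hg : Measurable g) (hh : Measurable h)
    (hf1 : ⨆ x, f x ≠ ∞) (hg1 : ⨆ x, g x ≠ ∞)
    (H : ∀ x y, f x ^ s * g y ^ t ≤ h (s * x + t * y)) :
    (∫⁻ x, f x) ^ s * (∫⁻ x, g x) ^ t ≤ ∫⁻ x, h x := by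
  set a := ⨆ x, f x with ha
  set b := ⨆ x, g x with hb
  rcases eq_or_ne a 0 with ha0 | ha0
  · have : f = 0 := by
      funext x
      exact le_antisymm ((le_iSup f x).trans_eq ha0) bot_le
    simp [this, hs]
  rcases eq_or_ne b 0 with hb0 | hb0
  · have : g = 0 := by
      funext x
      exact le_antisymm ((le_iSup g x).trans_eq hb0) bot_le
    simp [this, ht]
  have hc0 : a ^ s * b ^ t ≠ 0 := by
    simp [ha0, hb0, hf1, hg1, ENNReal.rpow_eq_zero_iff]
  have hct : a ^ s * b ^ t ≠ ∞ := ENNReal.mul_ne_top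
    (ENNReal.rpow_ne_top_of_nonneg hs.le hf1) (ENNReal.rpow_ne_top_of_nonneg ht.le hg1)
  have hinv : (a ^ s * b ^ t)⁻¹ = (a⁻¹) ^ s * (b⁻¹) ^ t := by
    rw [ENNReal.mul_inv (Or.inr (ENNReal.rpow_ne_top_of_nonneg ht.le hg1))
      (Or.inl (ENNReal.rpow_ne_top_of_nonneg hs.le hf1)), ENNReal.inv_rpow, ENNReal.inv_rpow]
  have h1 := lintegral_add_le_of_iSup_eq_one hs ht hst (hf.const_mul a⁻¹) (hg.const_mul b⁻¹)
    (hh.const_mul (a ^ s * b ^ t)⁻¹)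
    (by rw [← ENNReal.mul_iSup, ← ha, ENNReal.inv_mul_cancel ha0 hf1])
    (by rw [← ENNReal.mul_iSup, ← hb, ENNReal.inv_mul_cancel hb0 hg1])
    (fun x y => by
      rw [ENNReal.mul_rpow_of_nonneg _ _ hs.le, ENNReal.mul_rpow_of_nonneg _ _ ht.le,
        mul_mul_mul_comm, hinv]
      gcongr
      exact H x y)
  have h2 := (ENNReal_geom_mean_le_arith_mean hs ht hst _ _).trans h1
  rw [lintegral_const_mul _ hf, lintegral_const_mul _ hg, lintegral_const_mul _ hh,
    ENNReal.mul_rpow_of_nonneg _ _ hs.le, ENNReal.mul_rpow_of_nonneg _ _ ht.le,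
    mul_mul_mul_comm, ← hinv] at h2
  rwa [ENNReal.mul_le_mul_iff_right (by simpa using hct) (by simpa using hc0)] at h2

theorem ENNReal_iSup_rpow {ι : Sort*} {s : ℝ} (hs : 0 < s) (a : ι → ℝ≥0∞) :
    (⨆ i, a i) ^ s = ⨆ i, a i ^ s :=
  (ENNReal.orderIsoRpow s hs).map_iSup a

theorem lintegral_eq_iSup_min {X : Type*} [MeasurableSpace X] {μ : Measure X} {f : X → ℝ≥0∞}
    (hf : Measurable f) : ∫⁻ x, f x ∂μ = ⨆ n : ℕ, ∫⁻ x, min (f x) n ∂μ := by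
  rw [← lintegral_iSup (fun n => hf.min measurable_const)]
  · refine lintegral_congr fun x => ?_
    rw [← inf_iSup_eq, ENNReal.iSup_natCast, inf_top_eq]
  · intro m n hmn x
    exact min_le_min le_rfl (by exact_mod_cast hmn)

theorem hasPrekopaLeindler_real {s t : ℝ} (hs : 0 < s) (ht : 0 < t) (hst : s + t = 1) :
    HasPrekopaLeindler (volume : Measure ℝ) (fun x y => s * x + t * y) s t := by
  intro f g h hf hg hh H
  rw [lintegral_eq_iSup_min hf, lintegral_eq_iSup_min hg, ENNReal_iSup_rpow hs,
    ENNReal_iSup_rpow ht, ENNReal.iSup_mul]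
  refine iSup_le fun N => ?_
  rw [ENNReal.mul_iSup]
  refine iSup_le fun M => ?_
  refine lintegral_rpow_mul_le_of_bounded hs ht hst (hf.min measurable_const)
    (hg.min measurable_const) hh ?_ ?_ fun x y => le_trans ?_ (H x y)
  · exact ((iSup_le fun x => min_le_right _ _).trans_lt (ENNReal.natCast_lt_top N)).ne
  · exact ((iSup_le fun x => min_le_right _ _).trans_lt (ENNReal.natCast_lt_top M)).ne
  · gcongr
    · exact min_le_left _ _
    · exact min_le_left _ _

/-- By Fubini: the inequality on the fibres is the hypothesis of the inequality for the marginals.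
-/
theorem HasPrekopaLeindler.prod {X Y : Type*} [MeasurableSpace X] [MeasurableSpace Y]
    {μ : Measure X} {ν : Measure Y} [SFinite μ] [SFinite ν] {m : X → X → X} {m' : Y → Y → Y}
    {s t : ℝ} (h₁ : HasPrekopaLeindler μ m s t) (h₂ : HasPrekopaLeindler ν m' s t) :
    HasPrekopaLeindler (μ.prod ν) (fun a b => (m a.1 b.1, m' a.2 b.2)) s t := by
  intro f g h hf hg hh H
  rw [lintegral_prod _ hf.aemeasurable, lintegral_prod _ hg.aemeasurable,
    lintegral_prod _ hh.aemeasurable]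
  refine h₁ _ _ _ hf.lintegral_prod_right' hg.lintegral_prod_right' hh.lintegral_prod_right'
    fun x y => ?_
  exact h₂ _ _ _ (hf.comp measurable_prodMk_left) (hg.comp measurable_prodMk_left)
    (hh.comp measurable_prodMk_left) fun x' y' => H (x, x') (y, y')

theorem HasPrekopaLeindler.of_measurePreserving {X Y : Type*} [MeasurableSpace X]
    [MeasurableSpace Y] {μ : Measure X} {ν : Measure Y} {m : X → X → X} {m' : Y → Y → Y}
    {s t : ℝ} (h : HasPrekopaLeindler μ m s t) (e : X ≃ᵐ Y) (he : MeasurePreserving e μ ν)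
    (hm : ∀ x y, e (m x y) = m' (e x) (e y)) : HasPrekopaLeindler ν m' s t := by
  intro f g k hf hg hk H
  rw [← he.lintegral_comp hf, ← he.lintegral_comp hg, ← he.lintegral_comp hk]
  exact h _ _ _ (hf.comp e.measurable) (hg.comp e.measurable) (hk.comp e.measurable)
    fun x y => by rw [hm]; exact H _ _

theorem HasPrekopaLeindler.pi_fin {μ : Measure ℝ} [SigmaFinite μ] {m : ℝ → ℝ → ℝ} {s t : ℝ}
    (h : HasPrekopaLeindler μ m s t) (n : ℕ) :
    HasPrekopaLeindler (Measure.pi fun _ : Fin n => μ) (fun x y i => m (x i) (y i)) s t := by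
  induction n with
  | zero =>
    intro f g k hf hg hk H
    rw [lintegral_unique, lintegral_unique, lintegral_unique]
    simp only [Measure.pi_empty_univ, mul_one]
    exact (H _ _).trans_eq (congrArg k (Subsingleton.elim _ _))
  | succ n ih =>
    have := (measurePreserving_piFinSuccAbove (fun _ : Fin (n + 1) => μ) 0).symm
    refine (h.prod ih).of_measurePreserving _ this fun x y => ?_
    funext i
    refine Fin.cases ?_ (fun j => ?_) i <;>
    simp [MeasurableEquiv.piFinSuccAbove, Fin.insertNthEquiv]

theorem HasPrekopaLeindler.pi {μ : Measure ℝ} [SigmaFinite μ] {m : ℝ → ℝ → ℝ} {s t : ℝ}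
    (h : HasPrekopaLeindler μ m s t) (ι : Type*) [Fintype ι] :
    HasPrekopaLeindler (Measure.pi fun _ : ι => μ) (fun x y i => m (x i) (y i)) s t := by
  let e := (Fintype.equivFin ι).symm
  have := measurePreserving_piCongrLeft (α := fun _ => ℝ) (fun _ : ι => μ) e
  refine (h.pi_fin (Fintype.card ι)).of_measurePreserving _ this fun x y => ?_
  funext i
  obtain ⟨j, rfl⟩ := e.surjective i
  simp only [MeasurableEquiv.coe_piCongrLeft, Equiv.piCongrLeft_apply_apply]

/-- The multiplicative Prékopa–Leindler inequality on the half line. -/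
theorem hasPrekopaLeindler_abs {s t : ℝ} (hs : 0 < s) (ht : 0 < t) (hst : s + t = 1) :
    HasPrekopaLeindler ((volume : Measure ℝ).map (fun x => |x|))
      (fun x y => |x| ^ s * |y| ^ t) s t := by
  intro f g h hf hg hh H
  -- Substituting |x| = e^u turns geometric means into arithmetic ones. The Jacobian e^u is
  -- log-linear, hence compatible with the exponents, and the factor 2 from the two half lines
  -- cancels because s + t = 1.
  have hexp : ∀ F : ℝ → ℝ≥0∞, Measurable F → ∫⁻ x, F x ∂((volume : Measure ℝ).map (fun x => |x|))
      = 2 * ∫⁻ u, ENNReal.ofReal (Real.exp u) * F (Real.exp u) := by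
    intro F hF
    rw [lintegral_map hF (by fun_prop)]
    have h1 : ∫⁻ x in Ioi (0 : ℝ), F |x| = ∫⁻ u, ENNReal.ofReal (Real.exp u) * F (Real.exp u) := by
      have := lintegral_image_eq_lintegral_abs_deriv_mul (s := univ) MeasurableSet.univ
        (fun x _ => (Real.hasDerivAt_exp x).hasDerivWithinAt) Real.exp_injective.injOn F
      rw [image_univ, Real.range_exp] at this
      simp only [abs_of_pos (Real.exp_pos _), Measure.restrict_univ] at this
      rw [← this]
      exact setLIntegral_congr_fun measurableSet_Ioi fun x hx => by
        simp only [abs_of_pos (show 0 < x from hx)]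
    have h2 : ∫⁻ x in Iic (0 : ℝ), F |x| = ∫⁻ x in Ioi (0 : ℝ), F |x| := by
      have := (Measure.measurePreserving_neg (volume : Measure ℝ)).setLIntegral_comp_preimage_emb
        (MeasurableEquiv.neg ℝ).measurableEmbedding (fun x => F |x|) (Iio 0)
      simp only [abs_neg] at this
      rw [setLIntegral_congr Iio_ae_eq_Iic.symm, ← this]
      simp
    rw [← lintegral_add_compl _ (measurableSet_Ioi (a := (0 : ℝ))), compl_Ioi, h2, h1, two_mul]
  rw [hexp f hf, hexp g hg, hexp h hh, ENNReal.mul_rpow_of_nonneg _ _ hs.le,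
    ENNReal.mul_rpow_of_nonneg _ _ ht.le, mul_mul_mul_comm,
    ← ENNReal.rpow_add _ _ (by simp) (by simp), hst, ENNReal.rpow_one]
  gcongr
  refine hasPrekopaLeindler_real hs ht hst _ _ _ (by fun_prop) (by fun_prop) (by fun_prop) ?_
  intro x y
  have h1 : Real.exp (s * x + t * y) = |Real.exp x| ^ s * |Real.exp y| ^ t := by
    rw [abs_of_pos (Real.exp_pos _), abs_of_pos (Real.exp_pos _), ← Real.exp_mul, ← Real.exp_mul,
      ← Real.exp_add]
    ring_nf
  rw [ENNReal.mul_rpow_of_nonneg _ _ hs.le, ENNReal.mul_rpow_of_nonneg _ _ ht.le,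
    mul_mul_mul_comm, h1]
  gcongr
  · rw [ENNReal.ofReal_rpow_of_pos (Real.exp_pos _), ENNReal.ofReal_rpow_of_pos (Real.exp_pos _),
      ← ENNReal.ofReal_mul (by positivity), abs_of_pos (Real.exp_pos _),
      abs_of_pos (Real.exp_pos _)]
  · exact H _ _

/-! ### Symmetrization along a set of coordinates -/

section Symmetrization

variable {ι : Type*} [DecidableEq ι]

/-- The reflection that changes the sign of the coordinates in `I`. -/
def flip (I : Finset ι) (x : ι → ℝ) : ι → ℝ := fun i => if i ∈ I then -x i else x i

/-- The coordinate projection onto `ℝ^I`. -/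
def cut (I : Finset ι) (x : ι → ℝ) : ι → ℝ := fun i => if i ∈ I then x i else 0

theorem flip_flip (I : Finset ι) (x : ι → ℝ) : flip I (flip I x) = x := by
  funext i
  by_cases h : i ∈ I <;> simp [flip, h]

theorem flip_comm (I J : Finset ι) (x : ι → ℝ) : flip I (flip J x) = flip J (flip I x) := by
  funext i
  by_cases h : i ∈ I <;> by_cases h' : i ∈ J <;> simp [flip, h, h']

theorem flip_add (I : Finset ι) (x y : ι → ℝ) : flip I (x + y) = flip I x + flip I y := by
  funext i
  by_cases h : i ∈ I <;> simp [flip, h, add_comm]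

theorem flip_cut (I J : Finset ι) (x : ι → ℝ) : flip J (cut I x) = cut I (flip J x) := by
  funext i
  by_cases h : i ∈ I <;> by_cases h' : i ∈ J <;> simp [flip, cut, h, h']

theorem flip_cut_self (I : Finset ι) (x : ι → ℝ) : flip I (cut I x) = -cut I x := by
  funext i
  by_cases h : i ∈ I <;> simp [flip, cut, h]

theorem flip_univ [Fintype ι] (x : ι → ℝ) : flip Finset.univ x = -x := by
  funext i
  simp [flip]

theorem continuous_flip (I : Finset ι) : Continuous (flip I) := by
  refine continuous_pi fun i => ?_
  by_cases h : i ∈ I <;> simp only [flip, h, if_true, if_false] <;> fun_prop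

/-- `√(F(y) F(z)) ≤ H(x)` whenever `y - z = 2 x` in the coordinates in `I` and `y = z = x` in the
other coordinates. -/
def SymmDominates (I : Finset ι) (F H : (ι → ℝ) → ℝ≥0∞) : Prop :=
  ∀ x v, F (x + cut I v) ^ (1 / 2 : ℝ) * F (flip I x + cut I v) ^ (1 / 2 : ℝ) ≤ H x

/-- The symmetrization of `F` in the coordinates in `I`. -/
def symm (I : Finset ι) (F : (ι → ℝ) → ℝ≥0∞) (x : ι → ℝ) : ℝ≥0∞ :=
  ⨆ v, F (x + cut I v) ^ (1 / 2 : ℝ) * F (flip I x + cut I v) ^ (1 / 2 : ℝ)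

theorem symmDominates_symm (I : Finset ι) (F : (ι → ℝ) → ℝ≥0∞) : SymmDominates I F (symm I F) :=
  fun x v => le_iSup (fun v => F (x + cut I v) ^ (1 / 2 : ℝ) *
    F (flip I x + cut I v) ^ (1 / 2 : ℝ)) v

theorem SymmDominates.rpow {I : Finset ι} {F H : (ι → ℝ) → ℝ≥0∞} (h : SymmDominates I F H)
    {α : ℝ} (hα : 0 ≤ α) : SymmDominates I (fun x => F x ^ α) (fun x => H x ^ α) := by
  intro x v
  have := ENNReal.rpow_le_rpow (h x v) hα
  rw [ENNReal.mul_rpow_of_nonneg _ _ hα, ← ENNReal.rpow_mul, ← ENNReal.rpow_mul] at this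
  simpa only [← ENNReal.rpow_mul, mul_comm] using this

/-- On each fibre with the coordinates outside I fixed, this is Prékopa–Leindler with exponents 1/2
for F and its reflection, which have the same integral. -/
theorem SymmDominates.lintegral_le [Fintype ι] {I : Finset ι} {F H : (ι → ℝ) → ℝ≥0∞}
    (h : SymmDominates I F H) (hF : Measurable F) (hH : Measurable H) :
    ∫⁻ x, F x ≤ ∫⁻ x, H x := by
  let e := MeasurableEquiv.piEquivPiSubtypeProd (fun _ : ι => ℝ) (fun i => i ∈ I)
  have he : MeasurePreserving e.symm := by
    convert (volume_preserving_piEquivPiSubtypeProd (fun _ : ι => ℝ) (fun i => i ∈ I)).symm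
  rw [← he.lintegral_comp hF, ← he.lintegral_comp hH]
  have hF' : Measurable fun z => F (e.symm z) := hF.comp e.symm.measurable
  have hH' : Measurable fun z => H (e.symm z) := hH.comp e.symm.measurable
  rw [Measure.volume_eq_prod, lintegral_prod_symm' _ hF', lintegral_prod_symm' _ hH']
  refine lintegral_mono fun b => ?_
  have pl := (hasPrekopaLeindler_real (s := 1 / 2) (t := 1 / 2) (by norm_num) (by norm_num)
    (by norm_num)).pi {i // i ∈ I}
  rw [← volume_pi] at pl
  have := pl (fun a => F (e.symm (a, b))) (fun a => F (e.symm (-a, b)))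
    (fun a => H (e.symm (a, b))) (hF'.comp measurable_prodMk_right)
    (hF'.comp (measurable_prodMk_right.comp measurable_neg)) (hH'.comp measurable_prodMk_right) ?_
  · have hneg : ∫⁻ a, F (e.symm (-a, b)) = ∫⁻ a, F (e.symm (a, b)) :=
      (Measure.measurePreserving_neg (volume : Measure ({i // i ∈ I} → ℝ))).lintegral_comp
        (f := fun a => F (e.symm (a, b))) (hF'.comp measurable_prodMk_right)
    rw [hneg, ← ENNReal.rpow_add_of_nonneg _ _ (by norm_num) (by norm_num)] at this
    norm_num at this
    exact this
  · intro x y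
    -- The midpoint (x + y)/2 and the shift (x - y)/2 are chosen so that the two arguments of F
    -- become x and -y in the coordinates of I.
    have key := h (e.symm (fun i => 1 / 2 * x i + 1 / 2 * y i, b))
      (e.symm (fun i => 1 / 2 * x i - 1 / 2 * y i, 0))
    have e1 : e.symm (fun i => 1 / 2 * x i + 1 / 2 * y i, b) +
        cut I (e.symm (fun i => 1 / 2 * x i - 1 / 2 * y i, 0)) = e.symm (x, b) := by
      funext i
      by_cases hi : i ∈ I
      · simp [e, cut, hi, MeasurableEquiv.piEquivPiSubtypeProd, Equiv.piEquivPiSubtypeProd]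
        ring
      · simp [e, cut, hi, MeasurableEquiv.piEquivPiSubtypeProd, Equiv.piEquivPiSubtypeProd]
    have e2 : flip I (e.symm (fun i => 1 / 2 * x i + 1 / 2 * y i, b)) +
        cut I (e.symm (fun i => 1 / 2 * x i - 1 / 2 * y i, 0)) = e.symm (-y, b) := by
      funext i
      by_cases hi : i ∈ I
      · simp [e, cut, flip, hi, MeasurableEquiv.piEquivPiSubtypeProd, Equiv.piEquivPiSubtypeProd]
        ring
      · simp [e, cut, flip, hi, MeasurableEquiv.piEquivPiSubtypeProd, Equiv.piEquivPiSubtypeProd]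
    rwa [e1, e2] at key

/-- The symmetrization inequality with a weight that is a product of quasi-concave weights
invariant under the reflections. -/
theorem SymmDominates.lintegral_mul_prod_le [Fintype ι] {κ : Type*} {I : Finset ι}
    (w : κ → (ι → ℝ) → ℝ≥0∞) (hw : ∀ j, Measurable (w j))
    (hwI : ∀ j x, w j (flip I x) = w j x)
    (hwc : ∀ j x v, min (w j (x + v)) (w j (x - v)) ≤ w j x) (s : Finset κ) :
    ∀ {F H : (ι → ℝ) → ℝ≥0∞}, SymmDominates I F H → Measurable F → Measurable H →
      ∫⁻ x, F x * ∏ j ∈ s, w j x ≤ ∫⁻ x, H x * ∏ j ∈ s, w j x := by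
  classical
  induction s using Finset.induction_on with
  | empty =>
    intro F H h hF hH
    simpa using h.lintegral_le hF hH
  | insert j s hj ih =>
    intro F H h hF hH
    have hP : Measurable fun x => ∏ j ∈ s, w j x := Finset.measurable_prod _ fun j _ => hw j
    have split : ∀ {F : (ι → ℝ) → ℝ≥0∞}, Measurable F → ∫⁻ x, F x * ∏ j ∈ insert j s, w j x
        = ∫⁻ r in Ioi (0 : ℝ), ∫⁻ x, {x | ENNReal.ofReal r < w j x}.indicator F x *
            ∏ j ∈ s, w j x := by
      intro F hF
      have := lintegral_mul_eq_lintegral_lt (μ := volume) (hF.mul hP) (hw j)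
      simp only [Pi.mul_apply] at this
      calc _ = ∫⁻ x, (F x * ∏ j ∈ s, w j x) * w j x := by
            refine lintegral_congr fun x => ?_
            rw [Finset.prod_insert hj]; ring
        _ = _ := this
        _ = _ := by
            refine lintegral_congr fun r => lintegral_congr fun x => ?_
            by_cases hx : x ∈ {x | ENNReal.ofReal r < w j x}
            · simp only [indicator_of_mem hx, Pi.mul_apply]
            · simp only [indicator_of_notMem hx, zero_mul]
    rw [split hF, split hH]
    refine lintegral_mono fun r => ?_
    have hm : MeasurableSet {x | ENNReal.ofReal r < w j x} :=
      measurableSet_lt measurable_const (hw j)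
    -- Restriction to a superlevel set of `w j` keeps the domination: if both arguments of F lie in
    -- the set, reflecting the second gives x + v and x - v in it, so quasi-concavity puts x there.
    -- The induction hypothesis is needed for these truncated functions, hence the quantification
    -- over F and H.
    refine ih ?_ (hF.indicator hm) (hH.indicator hm)
    intro x v
    by_cases h1 : x + cut I v ∈ {x | ENNReal.ofReal r < w j x}
    · by_cases h2 : flip I x + cut I v ∈ {x | ENNReal.ofReal r < w j x}
      · have h3 : x ∈ {x | ENNReal.ofReal r < w j x} := by
          refine lt_of_lt_of_le (lt_min h1 ?_) (hwc j x (cut I v))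
          have : x - cut I v = flip I (flip I x + cut I v) := by
            rw [flip_add, flip_flip, flip_cut_self, sub_eq_add_neg]
          rw [this, hwI]
          exact h2
        rw [indicator_of_mem h1, indicator_of_mem h2, indicator_of_mem h3]
        exact h x v
      · rw [indicator_of_notMem h2]
        simp
    · rw [indicator_of_notMem h1]
      simp

/-- Multiplication on [0, ∞] is not continuous at (0, ∞), but any value below a product is below a
product of strictly smaller factors, which is enough. -/
theorem lowerSemicontinuous_rpow_mul_rpow {X : Type*} [TopologicalSpace X] {F G : X → ℝ≥0∞}
    (hF : LowerSemicontinuous F) (hG : LowerSemicontinuous G) {α : ℝ} (hα : 0 ≤ α) :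
    LowerSemicontinuous fun x => F x ^ α * G x ^ α := by
  have hr : ∀ {F : X → ℝ≥0∞}, LowerSemicontinuous F → LowerSemicontinuous fun x => F x ^ α :=
    fun hF => (ENNReal.continuous_rpow_const (y := α)).comp_lowerSemicontinuous hF
      (ENNReal.monotone_rpow_of_nonneg hα)
  intro x c hc
  obtain ⟨a, ha, b, hb, hab⟩ : ∃ a < F x ^ α, ∃ b < G x ^ α, c < a * b := by
    by_contra! hcon
    exact absurd (ENNReal.mul_le_of_forall_lt hcon) (not_le.2 hc)
  filter_upwards [hr hF x a ha, hr hG x b hb] with y hy hy'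
  exact hab.trans_le (mul_le_mul' hy.le hy'.le)

theorem lowerSemicontinuous_symm (I : Finset ι) {F : (ι → ℝ) → ℝ≥0∞}
    (hF : LowerSemicontinuous F) : LowerSemicontinuous (symm I F) := by
  refine lowerSemicontinuous_iSup fun v => ?_
  refine lowerSemicontinuous_rpow_mul_rpow (hF.comp (by fun_prop))
    (hF.comp ?_) (by norm_num)
  exact (continuous_flip I).add continuous_const

theorem symm_flip_self (I : Finset ι) (F : (ι → ℝ) → ℝ≥0∞) (x : ι → ℝ) :
    symm I F (flip I x) = symm I F x := by
  simp only [symm, flip_flip, mul_comm]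

theorem symm_flip {I J : Finset ι} {F : (ι → ℝ) → ℝ≥0∞} (hF : ∀ x, F (flip J x) = F x)
    (x : ι → ℝ) : symm I F (flip J x) = symm I F x := by
  simp only [symm]
  have hinv : Function.Involutive (flip J : (ι → ℝ) → ι → ℝ) := flip_flip J
  refine (hinv.surjective.iSup_congr (flip J) fun v => ?_).symm
  rw [← hF (x + cut I v), ← hF (flip I x + cut I v), flip_add, flip_add, flip_cut, flip_comm I J]

theorem flip_invariant_of_singletons [Fintype ι] {F : (ι → ℝ) → ℝ≥0∞}
    (hF : ∀ i x, F (flip {i} x) = F x) (J : Finset ι) (x : ι → ℝ) : F (flip J x) = F x := by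
  induction J using Finset.induction_on with
  | empty => congr 1
  | insert i J hi ih =>
    rw [← ih, ← hF i (flip J x)]
    congr 1
    funext k
    by_cases hk : k = i
    · subst hk; simp [flip, hi]
    · simp [flip, hk]

/-- `F G` is bounded by a multiple of `e^{-⟨x, u⟩}`. -/
def IsPolarPair [Fintype ι] (C : ℝ≥0∞) (F G : (ι → ℝ) → ℝ≥0∞) : Prop :=
  ∀ x u, F x * G u ≤ C * ENNReal.ofReal (Real.exp (-(x ⬝ᵥ u)))

/-- Evenness of G allows the second argument of G to be negated. The sum of the two scalar products
is then 2⟨x,u⟩: the shifts v and v' live in complementary coordinates and cancel. The square root of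
the product of the two bounds is the original bound. -/
theorem IsPolarPair.symm [Fintype ι] {C : ℝ≥0∞} {F G : (ι → ℝ) → ℝ≥0∞} (h : IsPolarPair C F G)
    (hG : ∀ x, G (-x) = G x) (i : ι) :
    IsPolarPair C (BlaschkeSantalo.symm {i} F) (BlaschkeSantalo.symm {i}ᶜ G) := by
  intro x u
  simp only [BlaschkeSantalo.symm]
  rw [ENNReal.iSup_mul]
  refine iSup_le fun v => ?_
  rw [ENNReal.mul_iSup]
  refine iSup_le fun v' => ?_
  rw [← hG (flip {i}ᶜ u + _), mul_mul_mul_comm, ← ENNReal.mul_rpow_of_nonneg _ _ (by norm_num),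
    ← ENNReal.mul_rpow_of_nonneg _ _ (by norm_num)]
  refine (mul_le_mul' (ENNReal.rpow_le_rpow (h _ _) (by norm_num))
    (ENNReal.rpow_le_rpow (h _ _) (by norm_num))).trans_eq ?_
  rw [← ENNReal.mul_rpow_of_nonneg _ _ (by norm_num), mul_mul_mul_comm,
    ← ENNReal.ofReal_mul (Real.exp_nonneg _), ← Real.exp_add]
  have key : -((x + cut {i} v) ⬝ᵥ (u + cut {i}ᶜ v')) +
      -((flip {i} x + cut {i} v) ⬝ᵥ -(flip {i}ᶜ u + cut {i}ᶜ v')) = -(x ⬝ᵥ u) + -(x ⬝ᵥ u) := by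
    simp only [dotProduct, ← Finset.sum_neg_distrib, ← Finset.sum_add_distrib]
    refine Finset.sum_congr rfl fun j _ => ?_
    by_cases hj : j = i <;> simp [cut, flip, hj] <;> ring
  rw [key, Real.exp_add, ENNReal.ofReal_mul (Real.exp_nonneg _), mul_mul_mul_comm,
    ENNReal.mul_rpow_of_nonneg _ _ (by norm_num),
    ← ENNReal.rpow_add_of_nonneg _ _ (by norm_num) (by norm_num)]
  norm_num

/-- Successive symmetrization turns an even polar pair into an unconditional one. -/
theorem exists_unconditional_pair [Fintype ι] {C : ℝ≥0∞} {F G W : (ι → ℝ) → ℝ≥0∞} {α : ℝ}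
    (hα : 0 ≤ α) (hFl : LowerSemicontinuous F) (hGl : LowerSemicontinuous G)
    (hFe : ∀ x, F (-x) = F x) (hGe : ∀ x, G (-x) = G x) (h : IsPolarPair C F G)
    (hW : ∀ (I : Finset ι) (F H : (ι → ℝ) → ℝ≥0∞), SymmDominates I F H → Measurable F →
      Measurable H → ∫⁻ x, F x * W x ≤ ∫⁻ x, H x * W x) :
    ∃ F' G' : (ι → ℝ) → ℝ≥0∞, Measurable F' ∧ Measurable G' ∧ IsPolarPair C F' G' ∧
      (∀ J x, F' (flip J x) = F' x) ∧ (∀ J x, G' (flip J x) = G' x) ∧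
      ∫⁻ x, F x ≤ ∫⁻ x, F' x ∧ ∫⁻ x, G x ^ α * W x ≤ ∫⁻ x, G' x ^ α * W x := by
  suffices key : ∀ S : Finset ι, ∃ F' G' : (ι → ℝ) → ℝ≥0∞, LowerSemicontinuous F' ∧
      LowerSemicontinuous G' ∧ IsPolarPair C F' G' ∧
      (∀ x, F' (flip Finset.univ x) = F' x) ∧ (∀ x, G' (flip Finset.univ x) = G' x) ∧
      (∀ i ∈ S, ∀ x, F' (flip {i} x) = F' x) ∧ (∀ i ∈ S, ∀ x, G' (flip {i} x) = G' x) ∧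
      ∫⁻ x, F x ≤ ∫⁻ x, F' x ∧ ∫⁻ x, G x ^ α * W x ≤ ∫⁻ x, G' x ^ α * W x by
    obtain ⟨F', G', h1, h2, h3, -, -, h4, h5, h6⟩ := key Finset.univ
    exact ⟨F', G', h1.measurable, h2.measurable, h3,
      flip_invariant_of_singletons fun i => h4 i (Finset.mem_univ i),
      flip_invariant_of_singletons fun i => h5 i (Finset.mem_univ i), h6⟩
  intro S
  induction S using Finset.induction_on with
  | empty =>
    exact ⟨F, G, hFl, hGl, h, by simpa [flip_univ] using hFe, by simpa [flip_univ] using hGe,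
      by simp, by simp, le_rfl, le_rfl⟩
  | insert i S hi ih =>
    obtain ⟨F', G', h1, h2, h3, h4, h5, h6, h7, h8, h9⟩ := ih
    -- The symmetrized G is invariant under the reflection in the complement of i and under x ↦ -x;
    -- their composition is the reflection in i.
    have hGu : ∀ x, symm {i}ᶜ G' (flip {i} x) = symm {i}ᶜ G' x := by
      intro x
      rw [← symm_flip_self {i}ᶜ G' (flip {i} x), ← symm_flip h5 x]
      congr 1
      funext k
      by_cases hk : k = i <;> simp [flip, hk]
    refine ⟨symm {i} F', symm {i}ᶜ G', lowerSemicontinuous_symm _ h1,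
      lowerSemicontinuous_symm _ h2, h3.symm (by simpa [flip_univ] using h5) i, symm_flip h4,
      symm_flip h5, ?_, ?_, h8.trans ?_, h9.trans ?_⟩
    · intro k hk
      rcases Finset.mem_insert.1 hk with rfl | hk
      · exact symm_flip_self _ _
      · exact symm_flip (h6 k hk)
    · intro k hk
      rcases Finset.mem_insert.1 hk with rfl | hk
      · exact hGu
      · exact symm_flip (h7 k hk)
    · exact (symmDominates_symm {i} F').lintegral_le h1.measurable
        (lowerSemicontinuous_symm _ h1).measurable
    · exact hW {i}ᶜ _ _ ((symmDominates_symm {i}ᶜ G').rpow hα) (h2.measurable.pow_const _)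
        ((lowerSemicontinuous_symm _ h2).measurable.pow_const _)

end Symmetrization

/-! ### Changes of variables -/

theorem lintegral_eq_lintegral_sphere {E : Type*} [NormedAddCommGroup E] [NormedSpace ℝ E]
    [FiniteDimensional ℝ E] [Nontrivial E] [MeasurableSpace E] [BorelSpace E] (μ : Measure E)
    [μ.IsAddHaarMeasure] {F : E → ℝ≥0∞} (hF : Measurable F) :
    ∫⁻ y, F y ∂μ = ∫⁻ θ, ∫⁻ r in Ioi (0 : ℝ),
      ENNReal.ofReal (r ^ (Module.finrank ℝ E - 1)) * F (r • (θ : E)) ∂volume ∂μ.toSphere := by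
  have h1 : ∫⁻ y, F y ∂μ = ∫⁻ y : ({0}ᶜ : Set E), F y ∂(μ.comap (↑)) := by
    rw [lintegral_subtype_comap (measurableSet_singleton 0).compl, restrict_compl_singleton]
  have h2 := μ.measurePreserving_homeomorphUnitSphereProd.lintegral_comp_emb
    (Homeomorph.measurableEmbedding _) (fun z => F ((z.2 : ℝ) • (z.1 : E)))
  have h3 : ∀ y : ({0}ᶜ : Set E), ((homeomorphUnitSphereProd E y).2 : ℝ) •
      ((homeomorphUnitSphereProd E y).1 : E) = y := by
    intro y
    have hy : ‖(y : E)‖ ≠ 0 := norm_ne_zero_iff.2 y.2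
    simp [smul_smul, hy]
  simp only [h3] at h2
  have hm : Measurable fun z : Metric.sphere (0 : E) 1 × Ioi (0 : ℝ) =>
      F ((z.2 : ℝ) • (z.1 : E)) := hF.comp (by fun_prop)
  rw [h1, h2, lintegral_prod _ hm.aemeasurable]
  refine lintegral_congr fun θ => ?_
  have hm' : Measurable fun r : Ioi (0 : ℝ) => F ((r : ℝ) • (θ : E)) := hF.comp (by fun_prop)
  rw [Measure.volumeIoiPow, lintegral_withDensity_eq_lintegral_mul _ (by fun_prop) hm',
    ← lintegral_subtype_comap measurableSet_Ioi]
  rfl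

theorem lintegral_Ioi_comp_mul_rpow {B d : ℝ} (hB : 0 < B) (hd : 0 < d) (g : ℝ → ℝ≥0∞) :
    ∫⁻ r in Ioi (0 : ℝ), g r
      = ∫⁻ r in Ioi (0 : ℝ), ENNReal.ofReal (B * (d * r ^ (d - 1))) * g (B * r ^ d) := by
  have himg : (fun r : ℝ => B * r ^ d) '' Ioi 0 = Ioi 0 := by
    ext y
    constructor
    · rintro ⟨r, hr, rfl⟩
      exact mul_pos hB (Real.rpow_pos_of_pos hr d)
    · intro hy
      have hy' : 0 < y / B := div_pos hy hB
      refine ⟨(y / B) ^ d⁻¹, Real.rpow_pos_of_pos hy' _, ?_⟩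
      simp only
      rw [← Real.rpow_mul hy'.le, inv_mul_cancel₀ hd.ne', Real.rpow_one]
      field_simp
  have hinj : InjOn (fun r : ℝ => B * r ^ d) (Ioi 0) := by
    intro x hx y hy hxy
    have := mul_left_cancel₀ hB.ne' hxy
    exact (Real.rpow_left_inj (le_of_lt hx) (le_of_lt hy) hd.ne').1 this
  have := lintegral_image_eq_lintegral_abs_deriv_mul (f := fun r : ℝ => B * r ^ d)
    (f' := fun r => B * (d * r ^ (d - 1))) measurableSet_Ioi
    (fun x hx => ((Real.hasDerivAt_rpow_const (Or.inl (ne_of_gt hx))).const_mul B).hasDerivWithinAt)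
    hinj g
  rw [himg] at this
  rw [this]
  refine setLIntegral_congr_fun measurableSet_Ioi fun r hr => ?_
  have hr' : 0 < r := hr
  rw [abs_of_pos (by positivity)]

/-- Jacobian of r ↦ R = A l^a r^{1+a} on one ray in dimension m + 1, with the density expressed
through R l, the value of the gauge at the image point. With A, l, r written as exponentials it
becomes a linear identity between exponents. -/
theorem radial_density_identity (m : ℕ) {A a l r : ℝ} (hA : 0 < A) (ha : 0 ≤ a) (hl : 0 < l)
    (hr : 0 < r) :
    r ^ m = (A * l ^ a) * ((1 + a) * r ^ (1 + a - 1)) * ((A * l ^ a * r ^ (1 + a)) ^ m *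
      (A ^ (-((m + 1) / (1 + a))) / (1 + a) *
        ((A * l ^ a * r ^ (1 + a)) * l) ^ (-((m + 1) * a / (1 + a))))) := by
  have h1 : 0 < 1 + a := by linarith
  obtain ⟨α, rfl⟩ : ∃ α, A = Real.exp α := ⟨Real.log A, (Real.exp_log hA).symm⟩
  obtain ⟨β, rfl⟩ : ∃ β, l = Real.exp β := ⟨Real.log l, (Real.exp_log hl).symm⟩
  obtain ⟨ρ, rfl⟩ : ∃ ρ, r = Real.exp ρ := ⟨Real.log r, (Real.exp_log hr).symm⟩
  simp only [← Real.exp_mul, ← Real.exp_add, ← Real.exp_nat_mul]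
  have : ∀ X Y Z W : ℝ, Real.exp X * ((1 + a) * Real.exp Y) * (Real.exp Z *
      (Real.exp W / (1 + a) * Real.exp (((α + β * a + ρ * (1 + a)) + β) *
        (-((m + 1) * a / (1 + a)))))) = Real.exp (X + Y + Z + W + ((α + β * a + ρ * (1 + a)) + β) *
        (-((m + 1) * a / (1 + a)))) := by
    intro X Y Z W
    simp only [Real.exp_add X, Real.exp_add (X + _), Real.exp_add (X + _ + _),
      Real.exp_add (X + _ + _ + _)]
    field_simp
  rw [this]
  congr 1
  field_simp
  ring

/-- Change of variables for the radial stretch `y ↦ A L(y)^a y`. -/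
theorem lintegral_comp_radial {n : ℕ} (hn : n ≠ 0) {A a : ℝ} (hA : 0 < A) (ha : 0 ≤ a)
    {L : (Fin n → ℝ) → ℝ} (hL : Measurable L) (hLpos : ∀ x, x ≠ 0 → 0 < L x)
    (hLhom : ∀ r : ℝ, 0 < r → ∀ x, L (r • x) = r * L x) {F : (Fin n → ℝ) → ℝ≥0∞}
    (hF : Measurable F) :
    ∫⁻ y, F ((A * L y ^ a) • y) = ENNReal.ofReal (A ^ (-(n / (1 + a))) / (1 + a)) *
      ∫⁻ z, F z * ENNReal.ofReal (L z) ^ (-(n * a / (1 + a))) := by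
  obtain ⟨m, rfl⟩ := Nat.exists_eq_succ_of_ne_zero hn
  have h1 : 0 < 1 + a := by linarith
  have hw : Measurable fun z => F z * ENNReal.ofReal (L z) ^ (-((m.succ : ℕ) * a / (1 + a))) := by
    fun_prop
  rw [← lintegral_const_mul _ hw, lintegral_eq_lintegral_sphere volume (by fun_prop),
    lintegral_eq_lintegral_sphere volume (by fun_prop)]
  refine lintegral_congr fun θ => ?_
  have hθ : (θ : Fin m.succ → ℝ) ≠ 0 := by
    intro h
    have := θ.2
    rw [h] at this
    simp at this
  have hl := hLpos _ hθ
  have hB : 0 < A * L θ ^ a := by positivity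
  conv_rhs => rw [lintegral_Ioi_comp_mul_rpow hB h1]
  refine setLIntegral_congr_fun measurableSet_Ioi fun r hr => ?_
  have hr' : 0 < r := hr
  have hp : 0 < A * L θ ^ a * r ^ (1 + a) := by positivity
  have e1 : A * L (r • (θ : Fin m.succ → ℝ)) ^ a * r = A * L θ ^ a * r ^ (1 + a) := by
    rw [hLhom r hr', Real.mul_rpow hr'.le hl.le, Real.rpow_add hr', Real.rpow_one]
    ring
  have hid := radial_density_identity m hA ha hl hr'
  simp only [Module.finrank_fintype_fun_eq_card, Fintype.card_fin, Nat.succ_sub_one, smul_smul]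
  rw [e1, hLhom _ hp, ENNReal.ofReal_rpow_of_pos (by positivity)]
  conv_lhs => rw [hid]
  rw [ENNReal.ofReal_mul (by positivity), ENNReal.ofReal_mul (p := _ ^ m) (by positivity),
    ENNReal.ofReal_mul (p := _ / _) (by positivity)]
  push_cast
  ring

/-- The signed power `|t|^(a-1) t`. -/
def signedPow (a t : ℝ) : ℝ := |t| ^ (a - 1) * t

theorem abs_signedPow {a : ℝ} (ha : 0 < a) (t : ℝ) : |signedPow a t| = |t| ^ a := by
  rcases eq_or_ne t 0 with rfl | ht
  · simp [signedPow, Real.zero_rpow ha.ne']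
  · have : 0 < |t| := abs_pos.2 ht
    rw [signedPow, abs_mul, abs_of_nonneg (by positivity)]
    nth_rw 2 [← Real.rpow_one |t|]
    rw [← Real.rpow_add this]
    ring_nf

theorem signedPow_signedPow {a b : ℝ} (hb : 0 < b) {t : ℝ} (ht : t ≠ 0) :
    signedPow a (signedPow b t) = signedPow (a * b) t := by
  have : 0 < |t| := abs_pos.2 ht
  rw [signedPow, abs_signedPow hb, signedPow, signedPow, ← mul_assoc, ← Real.rpow_mul this.le,
    ← Real.rpow_add this]
  ring_nf

theorem signedPow_one (t : ℝ) : signedPow 1 t = t := by simp [signedPow]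

theorem signedPow_ne_zero {a t : ℝ} (ht : t ≠ 0) : signedPow a t ≠ 0 :=
  mul_ne_zero (Real.rpow_pos_of_pos (abs_pos.2 ht) _).ne' ht

theorem hasDerivAt_signedPow (a : ℝ) {t : ℝ} (ht : t ≠ 0) :
    HasDerivAt (signedPow a) (a * |t| ^ (a - 1)) t := by
  have h0 : 0 < |t| := abs_pos.2 ht
  have h1 := ((hasDerivAt_abs ht).rpow_const (p := a - 1) (Or.inl h0.ne')).mul (hasDerivAt_id t)
  refine h1.congr_deriv ?_
  have h2 : ((SignType.sign t : SignType) : ℝ) * t = |t| := sign_mul_self t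
  have h3 : |t| ^ (a - 1) = |t| ^ (a - 1 - 1) * |t| := by
    nth_rw 3 [← Real.rpow_one |t|]
    rw [← Real.rpow_add h0]
    ring_nf
  simp only [id]
  calc _ = (((SignType.sign t : SignType) : ℝ) * t) * (a - 1) * |t| ^ (a - 1 - 1) +
        |t| ^ (a - 1) := by ring
    _ = _ := by rw [h2, h3]; ring

theorem measurable_signedPow (a : ℝ) : Measurable (signedPow a) := by
  unfold signedPow
  fun_prop

/-- The density of the image of Lebesgue measure under the signed power `a⁻¹`. -/
def powDensity (a s : ℝ) : ℝ≥0∞ := ENNReal.ofReal a * ENNReal.ofReal |s| ^ (a - 1)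

theorem measurable_powDensity (a : ℝ) : Measurable (powDensity a) := by
  unfold powDensity
  fun_prop

theorem lintegral_comp_signedPow {a : ℝ} (ha : 0 < a) (F : ℝ → ℝ≥0∞) :
    ∫⁻ t, F (signedPow a t) = ∫⁻ s, F s * powDensity a⁻¹ s := by
  have himg : signedPow a '' {0}ᶜ = {0}ᶜ := by
    ext s
    constructor
    · rintro ⟨t, ht, rfl⟩
      exact signedPow_ne_zero ht
    · intro hs
      refine ⟨signedPow a⁻¹ s, signedPow_ne_zero hs, ?_⟩
      rw [signedPow_signedPow (by positivity) hs, mul_inv_cancel₀ ha.ne', signedPow_one]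
  have hinj : InjOn (signedPow a) {0}ᶜ := by
    intro x hx y hy hxy
    have := congrArg (signedPow a⁻¹) hxy
    rwa [signedPow_signedPow ha hx, signedPow_signedPow ha hy, inv_mul_cancel₀ ha.ne',
      signedPow_one, signedPow_one] at this
  have := lintegral_image_eq_lintegral_abs_deriv_mul (measurableSet_singleton (0 : ℝ)).compl
    (fun x hx => (hasDerivAt_signedPow a hx).hasDerivWithinAt) hinj
    (fun s => F s * powDensity a⁻¹ s)
  rw [himg, restrict_compl_singleton] at this
  rw [this]
  refine lintegral_congr_ae ?_
  filter_upwards [compl_mem_ae_iff.2 (measure_singleton (0 : ℝ))] with t ht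
  have h0 : 0 < |t| := abs_pos.2 ht
  have : ENNReal.ofReal |a * |t| ^ (a - 1)| * powDensity a⁻¹ (signedPow a t) = 1 := by
    rw [powDensity, abs_signedPow ha, ENNReal.ofReal_rpow_of_pos (by positivity),
      ← ENNReal.ofReal_mul (by positivity), ← ENNReal.ofReal_mul (by positivity),
      abs_of_pos (by positivity), ← Real.rpow_mul h0.le, ENNReal.ofReal_eq_one]
    calc _ = (a * a⁻¹) * (|t| ^ (a - 1) * |t| ^ (a * (a⁻¹ - 1))) := by ring
      _ = 1 := by
        rw [← Real.rpow_add h0, mul_inv_cancel₀ ha.ne', mul_sub, mul_inv_cancel₀ ha.ne']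
        simp
  calc _ = F (signedPow a t) * 1 := (mul_one _).symm
    _ = _ := by rw [← this]; ring

theorem lintegral_comp_pi {T : ℝ → ℝ} {w : ℝ → ℝ≥0∞} (hT : Measurable T) (hw : Measurable w)
    (h : ∀ F : ℝ → ℝ≥0∞, ∫⁻ t, F (T t) = ∫⁻ s, F s * w s) (n : ℕ) :
    ∀ {F : (Fin n → ℝ) → ℝ≥0∞}, Measurable F →
      ∫⁻ x : Fin n → ℝ, F (fun i => T (x i)) = ∫⁻ s, F s * ∏ i, w (s i) := by
  induction n with
  | zero =>
    intro F hF
    rw [lintegral_unique, lintegral_unique]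
    simp only [Finset.univ_eq_empty, Finset.prod_empty, mul_one]
    congr 2
    exact Subsingleton.elim _ _
  | succ n ih =>
    intro F hF
    have hp := (volume_preserving_piFinSuccAbove (fun _ : Fin (n + 1) => ℝ) 0).symm
    have he : ∀ z : ℝ × (Fin n → ℝ), (MeasurableEquiv.piFinSuccAbove (fun _ => ℝ) 0).symm z
        = Fin.cons z.1 z.2 := by
      intro z
      simp [MeasurableEquiv.piFinSuccAbove, Fin.insertNthEquiv]
    have split : ∀ {H : (Fin (n + 1) → ℝ) → ℝ≥0∞}, Measurable H →
        ∫⁻ x, H x = ∫⁻ t : ℝ, ∫⁻ x : Fin n → ℝ, H (Fin.cons t x : Fin (n + 1) → ℝ) := by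
      intro H hH
      rw [← hp.lintegral_comp hH, Measure.volume_eq_prod, lintegral_prod]
      · simp only [he]
      · exact (hH.comp (MeasurableEquiv.measurable _)).aemeasurable
    have hcons : ∀ t : ℝ, Measurable fun x : Fin n → ℝ => (Fin.cons t x : Fin (n + 1) → ℝ) := by
      intro t
      refine measurable_pi_lambda _ fun i => ?_
      refine Fin.cases ?_ (fun j => ?_) i
      · simp
      · simpa using measurable_pi_apply j
    have hcT : ∀ (t : ℝ) (x : Fin n → ℝ), (fun i => T ((Fin.cons t x : Fin (n + 1) → ℝ) i)) =
        (Fin.cons (T t) (fun i => T (x i)) : Fin (n + 1) → ℝ) := by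
      intro t x
      funext i
      refine Fin.cases ?_ (fun j => ?_) i <;> simp
    have hm1 : Measurable fun x : Fin (n + 1) → ℝ => F fun i => T (x i) :=
      hF.comp (measurable_pi_lambda _ fun i => hT.comp (measurable_pi_apply i))
    have hm2 : Measurable fun s : Fin (n + 1) → ℝ => F s * ∏ i, w (s i) :=
      hF.mul (Finset.measurable_fun_prod _ fun i _ => hw.comp (measurable_pi_apply i))
    have ih' : ∀ t : ℝ, ∫⁻ x : Fin n → ℝ, F (Fin.cons t fun i => T (x i))
        = ∫⁻ s : Fin n → ℝ, F (Fin.cons t s) * ∏ i, w (s i) :=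
      fun t => ih (hF.comp (hcons t))
    rw [split hm1, split hm2]
    simp only [hcT, ih']
    rw [h fun t => ∫⁻ s : Fin n → ℝ, F (Fin.cons t s) * ∏ i, w (s i)]
    refine lintegral_congr fun t => ?_
    rw [← lintegral_mul_const]
    · refine lintegral_congr fun s => ?_
      rw [Fin.prod_univ_succ]
      simp only [Fin.cons_zero, Fin.cons_succ]
      ring
    · exact (hF.comp (hcons t)).mul
        (Finset.measurable_fun_prod _ fun i _ => hw.comp (measurable_pi_apply i))

/-! ### The potential and its gradient in coordinates -/

/-- The `l^q`-norm on `ι → ℝ`. -/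
def lq {ι : Type*} [Fintype ι] (q : ℝ) (x : ι → ℝ) : ℝ := (∑ i, |x i| ^ q) ^ (1 / q)

/-- The gradient of `c |y|_q^p`. -/
def powGrad {ι : Type*} [Fintype ι] (p q c : ℝ) (y : ι → ℝ) : ι → ℝ :=
  fun i => c * p * lq q y ^ (p - q) * signedPow (q - 1) (y i)

theorem abs_flip {ι : Type*} [DecidableEq ι] (J : Finset ι) (x : ι → ℝ) (i : ι) :
    |flip J x i| = |x i| := by
  by_cases h : i ∈ J <;> simp [flip, h]

section Potential

variable {ι : Type*} [Fintype ι]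

theorem sum_abs_rpow_nonneg (q : ℝ) (x : ι → ℝ) : 0 ≤ ∑ i, |x i| ^ q :=
  Finset.sum_nonneg fun i _ => by positivity

theorem sum_abs_rpow_pos {q : ℝ} {x : ι → ℝ} (hx : x ≠ 0) : 0 < ∑ i, |x i| ^ q := by
  obtain ⟨i, hi⟩ := Function.ne_iff.1 hx
  refine Finset.sum_pos' (fun i _ => by positivity) ⟨i, Finset.mem_univ i, ?_⟩
  exact Real.rpow_pos_of_pos (abs_pos.2 hi) q

theorem lq_pos {q : ℝ} {x : ι → ℝ} (hx : x ≠ 0) : 0 < lq q x :=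
  Real.rpow_pos_of_pos (sum_abs_rpow_pos hx) _

theorem lq_rpow (q r : ℝ) (x : ι → ℝ) : lq q x ^ r = (∑ i, |x i| ^ q) ^ (r / q) := by
  rw [lq, ← Real.rpow_mul (sum_abs_rpow_nonneg q x)]
  ring_nf

theorem measurable_lq (q : ℝ) : Measurable (lq q : (ι → ℝ) → ℝ) := by
  unfold lq
  fun_prop

theorem measurable_powGrad (p q c : ℝ) : Measurable (powGrad p q c : (ι → ℝ) → ι → ℝ) := by
  refine measurable_pi_lambda _ fun i => ?_
  unfold powGrad
  exact (((measurable_lq q).pow_const _).const_mul _).mul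
    ((measurable_signedPow _).comp (measurable_pi_apply i))

theorem lq_smul {q : ℝ} (hq : q ≠ 0) {r : ℝ} (hr : 0 < r) (x : ι → ℝ) :
    lq q (r • x) = r * lq q x := by
  have : ∑ i, |(r • x) i| ^ q = r ^ q * ∑ i, |x i| ^ q := by
    rw [Finset.mul_sum]
    refine Finset.sum_congr rfl fun i _ => ?_
    rw [Pi.smul_apply, smul_eq_mul, abs_mul, abs_of_pos hr, Real.mul_rpow hr.le (abs_nonneg _)]
  rw [lq, this, Real.mul_rpow (by positivity) (sum_abs_rpow_nonneg q x), ← Real.rpow_mul hr.le,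
    mul_one_div_cancel hq, Real.rpow_one, lq]

theorem lq_flip [DecidableEq ι] (q : ℝ) (J : Finset ι) (x : ι → ℝ) :
    lq q (flip J x) = lq q x := by
  simp only [lq, abs_flip]

theorem powGrad_flip [DecidableEq ι] (p q c : ℝ) (J : Finset ι) (y : ι → ℝ) :
    powGrad p q c (flip J y) = flip J (powGrad p q c y) := by
  funext i
  by_cases h : i ∈ J <;> simp [powGrad, lq_flip, flip, h, signedPow]

theorem signedPow_mul (a : ℝ) {r : ℝ} (hr : 0 < r) (t : ℝ) :
    signedPow a (r * t) = r ^ a * signedPow a t := by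
  rw [signedPow, signedPow, abs_mul, abs_of_pos hr, Real.mul_rpow hr.le (abs_nonneg _)]
  have : r ^ a = r ^ (a - 1) * r := by
    nth_rw 3 [← Real.rpow_one r]
    rw [← Real.rpow_add hr]
    ring_nf
  rw [this]
  ring

/-- Since the signed power is homogeneous of degree q - 1, the scalar factor of ∇V can be moved
inside it. Hence ∇V is a radial stretch followed by a map acting on each coordinate separately, two
maps with explicit Jacobians. -/
theorem powGrad_eq {p q c : ℝ} (hq : 1 < q) (hp : 0 < p) (hc : 0 < c) (y : ι → ℝ) :
    powGrad p q c y = fun i => signedPow (q - 1)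
      ((((c * p) ^ (q - 1)⁻¹ * lq q y ^ ((p - q) / (q - 1))) • y) i) := by
  funext i
  have hq1 : q - 1 ≠ 0 := by linarith
  have hcp : 0 < c * p := by positivity
  rcases eq_or_ne y 0 with rfl | hy
  · simp [powGrad, signedPow]
  · have hl := lq_pos (q := q) hy
    rw [Pi.smul_apply, smul_eq_mul, signedPow_mul _ (by positivity),
      Real.mul_rpow (by positivity) (by positivity), ← Real.rpow_mul hcp.le,
      inv_mul_cancel₀ hq1, Real.rpow_one, ← Real.rpow_mul hl.le, div_mul_cancel₀ _ hq1, powGrad]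

/-- The factors of the density of the image of Lebesgue measure under `powGrad`. -/
def gradWeight (q b : ℝ) : Option ι → (ι → ℝ) → ℝ≥0∞
  | none, s => ENNReal.ofReal (∑ i, |s i| ^ (q / (q - 1))) ^ (-b)
  | some i, s => powDensity (q - 1)⁻¹ (s i)

theorem measurable_gradWeight (q b : ℝ) (j : Option ι) : Measurable (gradWeight q b j) := by
  cases j with
  | none => unfold gradWeight; fun_prop
  | some i => exact (measurable_powDensity _).comp (measurable_pi_apply i)

theorem gradWeight_flip [DecidableEq ι] (q b : ℝ) (j : Option ι) (I : Finset ι) (x : ι → ℝ) :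
    gradWeight q b j (flip I x) = gradWeight q b j x := by
  cases j <;> simp only [gradWeight, powDensity, abs_flip]

theorem ENNReal_rpow_le_rpow_of_nonpos {x y : ℝ≥0∞} (h : x ≤ y) {b : ℝ} (hb : b ≤ 0) :
    y ^ b ≤ x ^ b := by
  have := ENNReal.inv_le_inv.2 (ENNReal.rpow_le_rpow h (neg_nonneg.2 hb))
  simpa [ENNReal.rpow_neg] using this

theorem abs_le_half_add (x v : ℝ) : |x| ≤ 1 / 2 * |x + v| + 1 / 2 * |x - v| := by
  have := abs_add_le (x + v) (x - v)
  rw [show x + v + (x - v) = 2 * x by ring, abs_mul, abs_two] at this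
  linarith

/-- Each factor is a nonpositive power of an even convex function, and x is the midpoint of x + v
and x - v. The assumption q ≥ 2 makes the exponent 1/(q-1) - 1 of the coordinate factors
nonpositive. -/
theorem gradWeight_min_le {q b : ℝ} (hq : 2 ≤ q) (hb : 0 ≤ b) (j : Option ι) (x v : ι → ℝ) :
    min (gradWeight q b j (x + v)) (gradWeight q b j (x - v)) ≤ gradWeight q b j x := by
  have hq1 : 0 < q - 1 := by linarith
  cases j with
  | none =>
    simp only [gradWeight]
    set r := q / (q - 1)
    have hr : 1 ≤ r := (one_le_div hq1).2 (by linarith)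
    have key : ∑ i, |x i| ^ r ≤
        1 / 2 * ∑ i, |(x + v) i| ^ r + 1 / 2 * ∑ i, |(x - v) i| ^ r := by
      rw [Finset.mul_sum, Finset.mul_sum, ← Finset.sum_add_distrib]
      refine Finset.sum_le_sum fun i _ => ?_
      refine (Real.rpow_le_rpow (abs_nonneg _) (abs_le_half_add (x i) (v i)) (by linarith)).trans ?_
      simpa using (convexOn_rpow hr).2 (abs_nonneg (x i + v i)) (abs_nonneg (x i - v i))
        (by norm_num : (0 : ℝ) ≤ 1 / 2) (by norm_num : (0 : ℝ) ≤ 1 / 2) (by norm_num)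
    rcases le_total (∑ i, |(x + v) i| ^ r) (∑ i, |(x - v) i| ^ r) with h | h
    · exact (min_le_right _ _).trans (ENNReal_rpow_le_rpow_of_nonpos
        (ENNReal.ofReal_le_ofReal (by linarith)) (by linarith))
    · exact (min_le_left _ _).trans (ENNReal_rpow_le_rpow_of_nonpos
        (ENNReal.ofReal_le_ofReal (by linarith)) (by linarith))
  | some i =>
    simp only [gradWeight, powDensity]
    have hk : (q - 1)⁻¹ - 1 ≤ 0 := by
      have := inv_le_one_of_one_le₀ (show 1 ≤ q - 1 by linarith)
      linarith
    have key := abs_le_half_add (x i) (v i)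
    rcases le_total |x i + v i| |x i - v i| with h | h
    · refine (min_le_right _ _).trans ?_
      refine mul_le_mul' le_rfl ?_
      exact ENNReal_rpow_le_rpow_of_nonpos (ENNReal.ofReal_le_ofReal
        (show |x i| ≤ |x i - v i| by linarith)) hk
    · refine (min_le_left _ _).trans ?_
      refine mul_le_mul' le_rfl ?_
      exact ENNReal_rpow_le_rpow_of_nonpos (ENNReal.ofReal_le_ofReal
        (show |x i| ≤ |x i + v i| by linarith)) hk

end Potential

/-- The value of K is immaterial, because the formula is used on both sides of one comparison. Only
b ≥ 0 matters; it comes from p ≥ q. -/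
theorem exists_lintegral_comp_powGrad {n : ℕ} (hn : n ≠ 0) {p q c : ℝ} (hq : 1 < q) (hp : q ≤ p)
    (hc : 0 < c) : ∃ (K : ℝ≥0∞) (b : ℝ), 0 ≤ b ∧ ∀ F : (Fin n → ℝ) → ℝ≥0∞, Measurable F →
      ∫⁻ y, F (powGrad p q c y) = K * ∫⁻ s, F s * ∏ j, gradWeight q b j s := by
  have hq1 : 0 < q - 1 := by linarith
  set a := (p - q) / (q - 1) with ha_def
  have ha : 0 ≤ a := div_nonneg (by linarith) hq1.le
  set A := (c * p) ^ (q - 1)⁻¹ with hA_def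
  have hA : 0 < A := Real.rpow_pos_of_pos (mul_pos hc (by linarith)) _
  refine ⟨ENNReal.ofReal (A ^ (-(n / (1 + a))) / (1 + a)), n * a / (1 + a) / q, by positivity,
    fun F hF => ?_⟩
  have hN : Measurable fun (z : Fin n → ℝ) i => signedPow (q - 1) (z i) :=
    measurable_pi_lambda _ fun i => (measurable_signedPow _).comp (measurable_pi_apply i)
  simp only [powGrad_eq hq (by linarith : 0 < p) hc]
  rw [lintegral_comp_radial hn hA ha (measurable_lq q) (fun x hx => lq_pos hx)
    (fun r hr x => lq_smul (by linarith) hr x)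
    (F := fun z => F fun i => signedPow (q - 1) (z i)) (hF.comp hN)]
  congr 1
  have hw : ∀ z : Fin n → ℝ, ENNReal.ofReal (lq q z) ^ (-(n * a / (1 + a))) =
      gradWeight q (n * a / (1 + a) / q) none fun i => signedPow (q - 1) (z i) := by
    intro z
    simp only [gradWeight, abs_signedPow hq1, ← Real.rpow_mul (abs_nonneg _)]
    rw [mul_div_cancel₀ _ hq1.ne', lq, ← ENNReal.ofReal_rpow_of_nonneg
      (sum_abs_rpow_nonneg q z) (by positivity), ← ENNReal.rpow_mul]
    ring_nf
  simp only [hw]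
  rw [lintegral_comp_pi (measurable_signedPow (q - 1)) (measurable_powDensity (q - 1)⁻¹)
    (lintegral_comp_signedPow hq1) n
    (F := fun s => F s * gradWeight q (n * a / (1 + a) / q) none s)
    (hF.mul (measurable_gradWeight _ _ _))]
  refine lintegral_congr fun s => ?_
  rw [Fintype.prod_option, mul_assoc]
  rfl

/-! ### The unconditional case -/

theorem signedPow_of_pos {a t : ℝ} (ht : 0 < t) : signedPow a t = t ^ a := by
  rw [signedPow, abs_of_pos ht]
  nth_rw 2 [← Real.rpow_one t]
  rw [← Real.rpow_add ht]
  ring_nf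

/-- Hölder with exponent p/q and weights y_i^q, applied to (x_i/y_i)^{q/p}, then raised to the power
p/q. -/
theorem potential_geom_mean_le {ι : Type*} [Fintype ι] {p q c : ℝ} (hq : 1 < q) (hp : q ≤ p)
    (hc : 0 ≤ c) {x y : ι → ℝ} (hx : ∀ i, 0 ≤ x i) (hy : ∀ i, 0 ≤ y i) :
    c * lq q (fun i => x i ^ (1 / p) * y i ^ ((p - 1) / p)) ^ p
      ≤ 1 / p * (x ⬝ᵥ powGrad p q c y) := by
  have hp0 : 0 < p := by linarith
  have hq0 : 0 < q := by linarith
  have hpq : 1 ≤ p / q := (one_le_div hq0).2 hp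
  have h := Real.inner_le_weight_mul_Lp_of_nonneg Finset.univ hpq (fun i => y i ^ q)
    (fun i => (x i / y i) ^ (q / p)) (fun i => Real.rpow_nonneg (hy i) _)
    (fun i => Real.rpow_nonneg (div_nonneg (hx i) (hy i)) _)
  have e1 : ∀ i, y i ^ q * (x i / y i) ^ (q / p)
      = |x i ^ (1 / p) * y i ^ ((p - 1) / p)| ^ q := by
    intro i
    rw [abs_of_nonneg (mul_nonneg (Real.rpow_nonneg (hx i) _) (Real.rpow_nonneg (hy i) _))]
    -- Where y_i = 0 the quotient x_i / y_i has no meaning, but its weight y_i^q vanishes.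
    rcases (hy i).eq_or_lt with h0 | h0
    · rw [← h0, Real.zero_rpow hq0.ne', Real.zero_rpow (div_pos (by linarith) hp0).ne', mul_zero,
        zero_mul, Real.zero_rpow hq0.ne']
    · rw [Real.div_rpow (hx i) h0.le, Real.mul_rpow (Real.rpow_nonneg (hx i) _) (by positivity),
        ← Real.rpow_mul (hx i), ← Real.rpow_mul h0.le]
      have : y i ^ ((p - 1) / p * q) = y i ^ q / y i ^ (q / p) := by
        rw [← Real.rpow_sub h0]
        congr 1
        field_simp
      rw [this, show 1 / p * q = q / p by ring]
      ring
  have e2 : ∀ i, y i ^ q * ((x i / y i) ^ (q / p)) ^ (p / q)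
      = x i * signedPow (q - 1) (y i) := by
    intro i
    rw [← Real.rpow_mul (div_nonneg (hx i) (hy i)), show q / p * (p / q) = 1 by field_simp,
      Real.rpow_one]
    rcases (hy i).eq_or_lt with h0 | h0
    · simp [← h0, signedPow, Real.zero_rpow hq0.ne']
    · rw [signedPow_of_pos h0, Real.rpow_sub h0, Real.rpow_one]
      field_simp
  simp only [e1, e2] at h
  set Y := ∑ i, y i ^ q with hY
  set D := ∑ i, x i * signedPow (q - 1) (y i) with hD
  have hY0 : 0 ≤ Y := Finset.sum_nonneg fun i _ => Real.rpow_nonneg (hy i) _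
  have hD0 : 0 ≤ D := Finset.sum_nonneg fun i _ => mul_nonneg (hx i)
    (mul_nonneg (Real.rpow_nonneg (abs_nonneg _) _) (hy i))
  have hlq : lq q y ^ (p - q) = Y ^ (p / q - 1) := by
    rw [lq_rpow]
    simp only [abs_of_nonneg (hy _)]
    rw [← hY]
    congr 1
    field_simp
  have hdot : x ⬝ᵥ powGrad p q c y = c * p * Y ^ (p / q - 1) * D := by
    simp only [dotProduct, powGrad, hlq, hD, Finset.mul_sum]
    refine Finset.sum_congr rfl fun i _ => by ring
  have hmain : lq q (fun i => x i ^ (1 / p) * y i ^ ((p - 1) / p)) ^ p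
      ≤ Y ^ (p / q - 1) * D := by
    rw [lq_rpow]
    refine (Real.rpow_le_rpow (sum_abs_rpow_nonneg _ _) h (by positivity)).trans_eq ?_
    rw [Real.mul_rpow (Real.rpow_nonneg hY0 _) (Real.rpow_nonneg hD0 _), ← Real.rpow_mul hY0,
      ← Real.rpow_mul hD0, inv_mul_cancel₀ (by positivity), Real.rpow_one, sub_mul,
      inv_mul_cancel₀ (by positivity), one_mul]
  rw [hdot]
  calc _ ≤ c * (Y ^ (p / q - 1) * D) := by gcongr
    _ = _ := by field_simp

theorem isLocallyFiniteMeasure_map_abs :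
    IsLocallyFiniteMeasure ((volume : Measure ℝ).map fun x => |x|) := by
  refine ⟨fun x => ⟨Iio (|x| + 1), Iio_mem_nhds (by linarith [le_abs_self x]), ?_⟩⟩
  rw [Measure.map_apply (by fun_prop) measurableSet_Iio]
  refine (measure_mono (t := Ioo (-(|x| + 1)) (|x| + 1)) fun t ht => ?_).trans_lt
    measure_Ioo_lt_top
  exact abs_lt.1 ht

theorem flip_filter_neg {n : ℕ} (x : Fin n → ℝ) :
    flip (Finset.univ.filter fun i => x i < 0) x = fun i => |x i| := by
  funext i
  by_cases hi : x i < 0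
  · simp [flip, hi, abs_of_neg hi]
  · simp [flip, hi, abs_of_nonneg (not_lt.1 hi)]

theorem lintegral_pi_map_abs {n : ℕ} {F : (Fin n → ℝ) → ℝ≥0∞} (hF : Measurable F)
    (hFi : ∀ J x, F (flip J x) = F x) :
    ∫⁻ x, F x ∂(Measure.pi fun _ : Fin n => (volume : Measure ℝ).map fun x => |x|)
      = ∫⁻ x, F x := by
  have := isLocallyFiniteMeasure_map_abs
  have h := measurePreserving_pi (fun _ : Fin n => (volume : Measure ℝ))
    (fun _ => (volume : Measure ℝ).map fun x => |x|) (f := fun _ x => |x|)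
    (fun i => Measurable.measurePreserving (by fun_prop) _)
  rw [← h.lintegral_comp hF, ← volume_pi]
  refine lintegral_congr fun x => ?_
  rw [← hFi (Finset.univ.filter fun i => x i < 0) x, flip_filter_neg]

theorem santalo_unconditional {n : ℕ} {p q c : ℝ} (hq : 1 < q) (hp : q ≤ p) (hc : 0 ≤ c)
    {C : ℝ≥0∞} {F G : (Fin n → ℝ) → ℝ≥0∞} (hF : Measurable F) (hG : Measurable G)
    (hFi : ∀ J x, F (flip J x) = F x) (hGi : ∀ J x, G (flip J x) = G x)
    (h : IsPolarPair C F G) :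
    (∫⁻ x, F x) * (∫⁻ y, G (powGrad p q c y) ^ (1 / (p - 1))) ^ (p - 1)
      ≤ C * (∫⁻ x : Fin n → ℝ, ENNReal.ofReal (Real.exp (-(c * lq q x ^ p)))) ^ p := by
  have := isLocallyFiniteMeasure_map_abs
  have hp0 : 0 < p := by linarith
  have hp1 : 0 < p - 1 := by linarith
  have hV : Measurable fun x : Fin n → ℝ => ENNReal.ofReal (Real.exp (-(c * lq q x ^ p))) := by
    have := measurable_lq (ι := Fin n) q
    fun_prop
  have hg : Measurable fun y : Fin n → ℝ => G (powGrad p q c y) ^ (1 / (p - 1)) :=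
    (hG.comp (measurable_powGrad p q c)).pow_const _
  have pl := (hasPrekopaLeindler_abs (s := 1 / p) (t := (p - 1) / p) (by positivity)
    (by positivity) (by field_simp; ring)).pi (Fin n) F
    (fun y => G (powGrad p q c y) ^ (1 / (p - 1)))
    (fun x => C ^ (1 / p) * ENNReal.ofReal (Real.exp (-(c * lq q x ^ p)))) hF hg
    (hV.const_mul _) ?_
  · rw [lintegral_const_mul _ hV, lintegral_pi_map_abs hF hFi, lintegral_pi_map_abs hg
      (fun J x => by rw [powGrad_flip, hGi]), lintegral_pi_map_abs hV
      (fun J x => by rw [lq_flip])] at pl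
    have := ENNReal.rpow_le_rpow pl hp0.le
    rw [ENNReal.mul_rpow_of_nonneg _ _ hp0.le, ENNReal.mul_rpow_of_nonneg _ _ hp0.le,
      ← ENNReal.rpow_mul, ← ENNReal.rpow_mul, ← ENNReal.rpow_mul, one_div_mul_cancel hp0.ne',
      div_mul_cancel₀ _ hp0.ne', ENNReal.rpow_one, ENNReal.rpow_one] at this
    exact this
  · intro x y
    rw [← hFi (Finset.univ.filter fun i => x i < 0) x, flip_filter_neg,
      ← hGi (Finset.univ.filter fun i => y i < 0), ← powGrad_flip, flip_filter_neg,
      ← ENNReal.rpow_mul, show 1 / (p - 1) * ((p - 1) / p) = 1 / p by field_simp,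
      ← ENNReal.mul_rpow_of_nonneg _ _ (by positivity)]
    refine (ENNReal.rpow_le_rpow (h _ _) (by positivity)).trans ?_
    rw [ENNReal.mul_rpow_of_nonneg _ _ (by positivity),
      ENNReal.ofReal_rpow_of_pos (Real.exp_pos _), ← Real.exp_mul]
    gcongr
    have := potential_geom_mean_le hq hp hc (x := fun i => |x i|) (y := fun i => |y i|)
      (fun i => abs_nonneg _) (fun i => abs_nonneg _)
    linarith

/-- Symmetrization takes place in the variable u = ∇V(y), where polarity is bilinear; the change of
variables is then undone to apply the unconditional case. -/
theorem santalo_even {n : ℕ} (hn : n ≠ 0) {p q c : ℝ} (hq : 2 ≤ q) (hp : q ≤ p) (hc : 0 < c)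
    {C : ℝ≥0∞} {F G : (Fin n → ℝ) → ℝ≥0∞} (hF : LowerSemicontinuous F)
    (hG : LowerSemicontinuous G) (hFi : ∀ x, F (-x) = F x) (hGi : ∀ x, G (-x) = G x)
    (h : IsPolarPair C F G) :
    (∫⁻ x, F x) * (∫⁻ y, G (powGrad p q c y) ^ (1 / (p - 1))) ^ (p - 1)
      ≤ C * (∫⁻ x : Fin n → ℝ, ENNReal.ofReal (Real.exp (-(c * lq q x ^ p)))) ^ p := by
  have hp1 : 0 < p - 1 := by linarith
  obtain ⟨K, b, hb, hK⟩ := exists_lintegral_comp_powGrad hn (by linarith : 1 < q) hp hc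
  obtain ⟨F', G', hF', hG', h', hFi', hGi', h1, h2⟩ := exists_unconditional_pair
    (α := 1 / (p - 1)) (W := fun s => ∏ j, gradWeight q b j s) (by positivity) hF hG hFi hGi h
    (fun I F H hFH hF hH => hFH.lintegral_mul_prod_le (gradWeight q b)
      (measurable_gradWeight q b) (fun j x => gradWeight_flip q b j I x)
      (gradWeight_min_le hq hb) Finset.univ hF hH)
  refine le_trans ?_ (santalo_unconditional (by linarith) hp hc.le hF' hG' hFi' hGi' h')
  rw [hK (fun s => G s ^ (1 / (p - 1))) (hG.measurable.pow_const _),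
    hK (fun s => G' s ^ (1 / (p - 1))) (hG'.pow_const _)]
  gcongr

/-! ### Reduction to lower semicontinuous pairs -/

section Thicken

variable {ι : Type*} [Fintype ι]

/-- The supremum of `F` over the points of the ball of radius `R` at distance less than `δ`. -/
def thicken (δ R : ℝ) (F : (ι → ℝ) → ℝ≥0∞) (x : ι → ℝ) : ℝ≥0∞ :=
  ⨆ (x' : ι → ℝ) (_ : dist x x' < δ ∧ ‖x'‖ ≤ R), F x'

theorem lowerSemicontinuous_thicken (δ R : ℝ) (F : (ι → ℝ) → ℝ≥0∞) :
    LowerSemicontinuous (thicken δ R F) := by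
  intro x a ha
  simp only [thicken, lt_iSup_iff] at ha ⊢
  obtain ⟨x', ⟨h1, h2⟩, h3⟩ := ha
  filter_upwards [Metric.isOpen_ball.mem_nhds (Metric.mem_ball.2 h1)] with y hy
  exact ⟨x', ⟨Metric.mem_ball.1 hy, h2⟩, h3⟩

theorem le_thicken {δ R : ℝ} (hδ : 0 < δ) (F : (ι → ℝ) → ℝ≥0∞) {x : ι → ℝ} (hx : ‖x‖ ≤ R) :
    F x ≤ thicken δ R F x :=
  le_iSup₂_of_le x ⟨by simpa using hδ, hx⟩ le_rfl

theorem norm_flip [DecidableEq ι] (J : Finset ι) (x : ι → ℝ) : ‖flip J x‖ = ‖x‖ := by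
  simp only [Pi.norm_def]
  congr 2
  funext i
  ext
  simpa using abs_flip J x i

theorem dist_flip [DecidableEq ι] (J : Finset ι) (x y : ι → ℝ) :
    dist (flip J x) (flip J y) = dist x y := by
  rw [dist_eq_norm, dist_eq_norm, ← norm_flip J (x - y)]
  congr 1
  funext i
  by_cases h : i ∈ J <;> simp [flip, h]
  ring

theorem thicken_flip [DecidableEq ι] {J : Finset ι} {F : (ι → ℝ) → ℝ≥0∞}
    (hF : ∀ x, F (flip J x) = F x) (δ R : ℝ) (x : ι → ℝ) :
    thicken δ R F (flip J x) = thicken δ R F x := by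
  have hinv : Function.Involutive (flip J : (ι → ℝ) → ι → ℝ) := flip_flip J
  refine (hinv.surjective.iSup_congr (flip J) fun v => ?_).symm
  rw [dist_flip, norm_flip, hF]

theorem dotProduct_sub_le {δ R : ℝ} (hδ : 0 < δ) (hδ1 : δ ≤ 1) {x x' u u' : ι → ℝ}
    (hx : dist x x' < δ) (hu : dist u u' < δ) (hx' : ‖x'‖ ≤ R) (hu' : ‖u'‖ ≤ R) :
    x ⬝ᵥ u - x' ⬝ᵥ u' ≤ Fintype.card ι * ((2 * R + 1) * δ) := by
  rw [dotProduct, dotProduct, ← Finset.sum_sub_distrib, ← nsmul_eq_mul]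
  refine Finset.sum_le_card_nsmul _ _ _ fun i _ => ?_
  have h1 : |x i - x' i| ≤ δ := (dist_le_pi_dist x x' i).trans hx.le
  have h2 : |u i - u' i| ≤ δ := (dist_le_pi_dist u u' i).trans hu.le
  have h3 : |x' i| ≤ R := (norm_le_pi_norm x' i).trans hx'
  have h4 : |u' i| ≤ R := (norm_le_pi_norm u' i).trans hu'
  have e : x i * u i - x' i * u' i = (x i - x' i) * (u i - u' i) + (x i - x' i) * u' i +
    x' i * (u i - u' i) := by ring
  have b1 : (x i - x' i) * (u i - u' i) ≤ δ * 1 := (le_abs_self _).trans (by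
    rw [abs_mul]; exact mul_le_mul h1 (h2.trans hδ1) (abs_nonneg _) hδ.le)
  have b2 : (x i - x' i) * u' i ≤ δ * R := (le_abs_self _).trans (by
    rw [abs_mul]; exact mul_le_mul h1 h4 (abs_nonneg _) hδ.le)
  have b3 : x' i * (u i - u' i) ≤ R * δ := (le_abs_self _).trans (by
    rw [abs_mul]; exact mul_le_mul h3 h2 (abs_nonneg _) ((abs_nonneg _).trans h3))
  rw [e]
  linarith

/-- Inside a ball of radius R, moving both points by less than δ changes the scalar product by at
most a multiple of δ. This loss is why polar pairs carry a constant C. -/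
theorem IsPolarPair.thicken {F G : (ι → ℝ) → ℝ≥0∞} (h : IsPolarPair 1 F G) {δ R : ℝ}
    (hδ : 0 < δ) (hδ1 : δ ≤ 1) :
    IsPolarPair (ENNReal.ofReal (Real.exp (Fintype.card ι * ((2 * R + 1) * δ))))
      (BlaschkeSantalo.thicken δ R F) (BlaschkeSantalo.thicken δ R G) := by
  intro x u
  simp only [BlaschkeSantalo.thicken, ENNReal.iSup_mul, ENNReal.mul_iSup]
  refine iSup₂_le fun u' hu' => iSup₂_le fun x' hx' => (h _ _).trans ?_
  rw [one_mul, ← ENNReal.ofReal_mul (Real.exp_nonneg _), ← Real.exp_add]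
  refine ENNReal.ofReal_le_ofReal (Real.exp_le_exp.2 ?_)
  have := dotProduct_sub_le hδ hδ1 hx'.1 hu'.1 hx'.2 hu'.2
  linarith

/-- Continuity along an increasing union of sets, rather than of functions, so that F need not be
measurable. -/
theorem iSup_setLIntegral_norm_le {X : Type*} [MeasurableSpace X] {μ : Measure X}
    (g : X → ι → ℝ) (F : X → ℝ≥0∞) :
    ⨆ k : ℕ, ∫⁻ x in {x | ‖g x‖ ≤ k}, F x ∂μ = ∫⁻ x, F x ∂μ := by
  rw [← setLIntegral_iUnion_of_directed]
  · have : ⋃ k : ℕ, {x | ‖g x‖ ≤ k} = univ :=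
      eq_univ_of_forall fun x => mem_iUnion.2 (exists_nat_ge ‖g x‖)
    rw [this, Measure.restrict_univ]
  · refine Monotone.directed_le fun k l hkl x hx => ?_
    exact (show ‖g x‖ ≤ k from hx).trans (Nat.cast_le.2 hkl)

/-- An inequality for lower semicontinuous polar pairs with given symmetries holds for all polar
pairs with these symmetries. -/
theorem le_of_forall_lowerSemicontinuous [DecidableEq ι] {g : (ι → ℝ) → ι → ℝ}
    (hg : Measurable g) {α r : ℝ} (hα : 0 < α) (hr : 0 < r) {S : Set (Finset ι)} {K : ℝ≥0∞}
    (H : ∀ (C : ℝ≥0∞) (F G : (ι → ℝ) → ℝ≥0∞), LowerSemicontinuous F → LowerSemicontinuous G →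
      (∀ J ∈ S, ∀ x, F (flip J x) = F x) → (∀ J ∈ S, ∀ x, G (flip J x) = G x) →
      IsPolarPair C F G → (∫⁻ x, F x) * (∫⁻ y, G (g y) ^ α) ^ r ≤ C * K)
    {F G : (ι → ℝ) → ℝ≥0∞} (hF : ∀ J ∈ S, ∀ x, F (flip J x) = F x)
    (hG : ∀ J ∈ S, ∀ x, G (flip J x) = G x) (h : IsPolarPair 1 F G) :
    (∫⁻ x, F x) * (∫⁻ y, G (g y) ^ α) ^ r ≤ K := by
  have hm : ∀ {g : (ι → ℝ) → ι → ℝ}, Measurable g → ∀ k : ℕ,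
      MeasurableSet {y | ‖g y‖ ≤ k} := fun hg k => measurableSet_le (by fun_prop) (by fun_prop)
  have step : ∀ k : ℕ, (∫⁻ x in {x | ‖id x‖ ≤ k}, F x) *
      (∫⁻ y in {y | ‖g y‖ ≤ k}, G (g y) ^ α) ^ r ≤ K := by
    intro k
    -- For a fixed radius k the constant lost by thickening tends to 1 as δ → 0.
    have hlim : Tendsto (fun δ : ℝ => ENNReal.ofReal (Real.exp (Fintype.card ι *
        ((2 * (k : ℝ) + 1) * δ))) * K) (𝓝[>] 0) (𝓝 (1 * K)) := by
      refine ENNReal.Tendsto.mul_const ?_ (Or.inl one_ne_zero)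
      have : Continuous fun δ : ℝ => ENNReal.ofReal (Real.exp (Fintype.card ι *
        ((2 * (k : ℝ) + 1) * δ))) := ENNReal.continuous_ofReal.comp (by fun_prop)
      have := (this.tendsto 0).mono_left (nhdsWithin_le_nhds (s := Ioi 0))
      simpa using this
    rw [one_mul] at hlim
    refine ge_of_tendsto hlim ?_
    filter_upwards [Ioc_mem_nhdsGT (zero_lt_one' ℝ)] with δ hδ
    refine le_trans ?_ (H _ _ _ (lowerSemicontinuous_thicken δ k F)
      (lowerSemicontinuous_thicken δ k G) (fun J hJ => thicken_flip (hF J hJ) δ k)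
      (fun J hJ => thicken_flip (hG J hJ) δ k) (h.thicken hδ.1 hδ.2))
    gcongr ?_ * ?_ ^ r
    · refine (setLIntegral_mono' (hm measurable_id k) fun x hx => ?_).trans
        (setLIntegral_le_lintegral _ _)
      exact le_thicken hδ.1 F hx
    · refine (setLIntegral_mono' (hm hg k) fun x hx => ?_).trans
        (setLIntegral_le_lintegral _ _)
      exact ENNReal.rpow_le_rpow (le_thicken hδ.1 G hx) hα.le
  rw [← iSup_setLIntegral_norm_le id F,
    ← iSup_setLIntegral_norm_le g fun y => G (g y) ^ α, ENNReal_iSup_rpow hr, ENNReal.iSup_mul]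
  refine iSup_le fun k => ?_
  rw [ENNReal.mul_iSup]
  -- The two integrals are exhausted independently; the larger radius serves both.
  refine iSup_le fun l => le_trans ?_ (step (max k l))
  have hle : ∀ {g : (ι → ℝ) → ι → ℝ} {a b : ℕ}, a ≤ b → {y | ‖g y‖ ≤ a} ⊆ {y | ‖g y‖ ≤ b} :=
    fun {g a b} hab y hy => (show ‖g y‖ ≤ a from hy).trans (Nat.cast_le.2 hab)
  gcongr ?_ * ?_ ^ r
  · exact lintegral_mono_set (hle (le_max_left k l))
  · exact lintegral_mono_set (hle (le_max_right k l))

end Thicken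

/-! ### Transfer to Euclidean space -/

theorem hasGradientAt_potential {n : ℕ} {p q c : ℝ} (hq : 1 < q) {y : Fin n → ℝ} (hy : y ≠ 0) :
    HasGradientAt (fun x : EuclideanSpace ℝ (Fin n) => c * lqNorm q x ^ p)
      (WithLp.toLp 2 (powGrad p q c y)) (WithLp.toLp 2 y) := by
  have hq0 : q ≠ 0 := by linarith
  have hS : HasFDerivAt (fun x : EuclideanSpace ℝ (Fin n) => ∑ i, |x i| ^ q)
      (∑ i, (q * |y i| ^ (q - 2) * y i) • (EuclideanSpace.proj i : EuclideanSpace ℝ (Fin n) →L[ℝ] ℝ))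
      (WithLp.toLp 2 y) := by
    refine HasFDerivAt.fun_sum fun i _ => ?_
    have h1 : HasFDerivAt (fun x : EuclideanSpace ℝ (Fin n) => x i)
        (EuclideanSpace.proj i : EuclideanSpace ℝ (Fin n) →L[ℝ] ℝ) (WithLp.toLp 2 y) :=
      (EuclideanSpace.proj i : EuclideanSpace ℝ (Fin n) →L[ℝ] ℝ).hasFDerivAt
    exact (hasDerivAt_abs_rpow (y i) hq).comp_hasFDerivAt (WithLp.toLp 2 y) h1
  have hpos := sum_abs_rpow_pos (q := q) hy
  have hV := (hS.rpow_const (p := p / q) (Or.inl hpos.ne')).const_mul c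
  have hfun : (fun x : EuclideanSpace ℝ (Fin n) => c * lqNorm q x ^ p)
      = fun x => c * (∑ i, |x i| ^ q) ^ (p / q) := by
    funext x
    exact congrArg (c * ·) (lq_rpow q p fun i => x i)
  rw [hasGradientAt_iff_hasFDerivAt, hfun]
  refine hV.congr_fderiv ?_
  ext v
  have hlq : lq q y ^ (p - q) = (∑ i, |y i| ^ q) ^ (p / q - 1) := by
    rw [lq_rpow]
    congr 1
    field_simp
  simp only [InnerProductSpace.toDual_apply_apply, PiLp.inner_apply, powGrad, hlq, signedPow]
  simp only [smul_apply, sum_apply, smul_eq_mul, Finset.mul_sum]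
  refine Finset.sum_congr rfl fun i _ => ?_
  simp only [RCLike.inner_apply, conj_trivial]
  rw [show q - 1 - 1 = q - 2 by ring]
  field_simp
  rfl

theorem exp_neg_mul {α : ℝ} (hα : 0 < α) (a : EReal) :
    EReal.exp (-((α : EReal) * a)) = EReal.exp (-a) ^ α := by
  induction a with
  | bot => simp [EReal.coe_mul_bot_of_pos hα, ENNReal.top_rpow_of_pos hα]
  | top => simp [EReal.coe_mul_top_of_pos hα, ENNReal.zero_rpow_of_pos hα]
  | coe a =>
    rw [← EReal.coe_mul, ← EReal.coe_neg, ← EReal.coe_neg, EReal.exp_coe, EReal.exp_coe,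
      ENNReal.ofReal_rpow_of_pos (Real.exp_pos _), ← Real.exp_mul]
    ring_nf

theorem isPolarPair_legendre {n : ℕ} {Φ : EuclideanSpace ℝ (Fin n) → EReal} (hΦ : IsProper Φ) :
    IsPolarPair 1 (fun x => EReal.exp (-Φ (WithLp.toLp 2 x)))
      (fun u => EReal.exp (-legendre Φ (WithLp.toLp 2 u))) := by
  intro x u
  have hle : ((inner ℝ (WithLp.toLp 2 x) (WithLp.toLp 2 u : EuclideanSpace ℝ (Fin n)) : ℝ) : EReal)
      - Φ (WithLp.toLp 2 x) ≤ legendre Φ (WithLp.toLp 2 u) :=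
    le_iSup (fun x : EuclideanSpace ℝ (Fin n) =>
      ((inner ℝ x (WithLp.toLp 2 u) : ℝ) : EReal) - Φ x) (WithLp.toLp 2 x)
  have hinner : inner ℝ (WithLp.toLp 2 x) (WithLp.toLp 2 u : EuclideanSpace ℝ (Fin n))
      = x ⬝ᵥ u := by
    simp [PiLp.inner_apply, dotProduct, mul_comm]
  rw [hinner] at hle
  beta_reduce
  have hbot := hΦ.1 (WithLp.toLp 2 x)
  generalize Φ (WithLp.toLp 2 x) = a at hle hbot ⊢
  induction a with
  | bot => exact absurd rfl hbot
  | top => simp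
  | coe a =>
    refine (mul_le_mul' le_rfl (EReal.exp_le_exp_iff.2 (EReal.neg_le_neg_iff.2 hle))).trans_eq ?_
    rw [← EReal.coe_sub, ← EReal.coe_neg, ← EReal.coe_neg, ← EReal.exp_add, ← EReal.coe_add,
      EReal.exp_coe, one_mul]
    ring_nf

theorem legendre_flip {n : ℕ} {Φ : EuclideanSpace ℝ (Fin n) → EReal} {J : Finset (Fin n)}
    (hΦ : ∀ x, Φ (WithLp.toLp 2 (flip J x)) = Φ (WithLp.toLp 2 x)) (u : Fin n → ℝ) :
    legendre Φ (WithLp.toLp 2 (flip J u)) = legendre Φ (WithLp.toLp 2 u) := by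
  have hsurj : Function.Surjective
      fun x : EuclideanSpace ℝ (Fin n) => (WithLp.toLp 2 (flip J x.ofLp) : EuclideanSpace ℝ (Fin n)) :=
    fun x => ⟨WithLp.toLp 2 (flip J x.ofLp), by simp [flip_flip]⟩
  refine (hsurj.iSup_congr _ fun x => ?_).symm
  rw [hΦ]
  congr 2
  simp only [PiLp.inner_apply]
  refine Finset.sum_congr rfl fun i _ => ?_
  by_cases h : i ∈ J <;> simp [flip, h]

theorem generalizedBS_of_lowerSemicontinuous {n : ℕ} {p q c : ℝ} (hq : 1 < q) (hp : q ≤ p)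
    {S : Set (Finset (Fin n))}
    (H : ∀ (C : ℝ≥0∞) (F G : (Fin n → ℝ) → ℝ≥0∞), LowerSemicontinuous F → LowerSemicontinuous G →
      (∀ J ∈ S, ∀ x, F (flip J x) = F x) → (∀ J ∈ S, ∀ x, G (flip J x) = G x) →
      IsPolarPair C F G → (∫⁻ x, F x) * (∫⁻ y, G (powGrad p q c y) ^ (1 / (p - 1))) ^ (p - 1)
        ≤ C * (∫⁻ x : Fin n → ℝ, ENNReal.ofReal (Real.exp (-(c * lq q x ^ p)))) ^ p)
    {Φ : EuclideanSpace ℝ (Fin n) → EReal} (hΦ : IsProper Φ)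
    (hS : ∀ J ∈ S, ∀ x, Φ (WithLp.toLp 2 (flip J x)) = Φ (WithLp.toLp 2 x)) :
    GeneralizedBS p (fun x => c * lqNorm q x ^ p) Φ := by
  have hp1 : 0 < p - 1 := by linarith
  have hα : 0 < 1 / (p - 1) := by positivity
  have hE : ∀ f : EuclideanSpace ℝ (Fin n) → ℝ≥0∞,
      ∫⁻ x, f x = ∫⁻ x : Fin n → ℝ, f (WithLp.toLp 2 x) := fun f =>
    ((PiLp.volume_preserving_toLp (Fin n)).lintegral_comp_emb
      (MeasurableEquiv.toLp 2 (Fin n → ℝ)).measurableEmbedding f).symm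
  -- The formula for the gradient is needed only away from the origin, a null set when n > 0; for n
  -- = 0 all vectors coincide.
  have hgrad : ∀ᵐ y : Fin n → ℝ, gradient
      (fun x : EuclideanSpace ℝ (Fin n) => c * lqNorm q x ^ p) (WithLp.toLp 2 y)
        = WithLp.toLp 2 (powGrad p q c y) := by
    rcases Nat.eq_zero_or_pos n with rfl | hn
    · exact Eventually.of_forall fun y => Subsingleton.elim _ _
    · have : Nonempty (Fin n) := ⟨⟨0, hn⟩⟩
      filter_upwards [compl_mem_ae_iff.2 (measure_singleton (0 : Fin n → ℝ))] with y hy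
      exact (hasGradientAt_potential hq hy).gradient
  have key := le_of_forall_lowerSemicontinuous (measurable_powGrad p q c) hα hp1 H
    (fun J hJ x => by rw [hS J hJ]) (fun J hJ u => by rw [legendre_flip (hS J hJ)])
    (isPolarPair_legendre hΦ)
  rw [GeneralizedBS, hE, hE, hE]
  refine le_trans (le_of_eq ?_) key
  congr 2
  refine lintegral_congr_ae ?_
  filter_upwards [hgrad] with y hy
  rw [hy, exp_neg_mul hα]

end BlaschkeSantalo

end

/-! ### The two cases of the theorem -/

theorem mainTheorem2 (n : ℕ) (p q c : ℝ) (hc : 0 ≤ c) :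
    ((1 < q ∧ q ≤ p) →
      ∀ Φ : EuclideanSpace ℝ (Fin n) → EReal,
        BlaschkeSantalo.IsProper Φ → BlaschkeSantalo.IsUnconditional Φ →
          BlaschkeSantalo.GeneralizedBS p
            (fun x => c * BlaschkeSantalo.lqNorm q x ^ p) Φ) ∧
    ((2 ≤ q ∧ q ≤ p) →
      ∀ Φ : EuclideanSpace ℝ (Fin n) → EReal,
        BlaschkeSantalo.IsProper Φ → (∀ x, Φ (-x) = Φ x) →
          BlaschkeSantalo.GeneralizedBS p
            (fun x => c * BlaschkeSantalo.lqNorm q x ^ p) Φ) := by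
  have uncond : 1 < q → q ≤ p → ∀ Φ : EuclideanSpace ℝ (Fin n) → EReal,
      BlaschkeSantalo.IsProper Φ → (∀ (J : Finset (Fin n)) (x : Fin n → ℝ),
        Φ (WithLp.toLp 2 (BlaschkeSantalo.flip J x)) = Φ (WithLp.toLp 2 x)) →
      BlaschkeSantalo.GeneralizedBS p (fun x => c * BlaschkeSantalo.lqNorm q x ^ p) Φ := by
    intro hq hp Φ hΦ hi
    refine BlaschkeSantalo.generalizedBS_of_lowerSemicontinuous hq hp (S := Set.univ)
      (fun C F G hF hG hFi hGi h => ?_) hΦ (fun J _ => hi J)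
    exact BlaschkeSantalo.santalo_unconditional hq hp hc hF.measurable hG.measurable
      (fun J => hFi J trivial) (fun J => hGi J trivial) h
  refine ⟨fun ⟨hq, hp⟩ Φ hΦ hi => uncond hq hp Φ hΦ fun J x => ?_,
    fun ⟨hq, hp⟩ Φ hΦ he => ?_⟩
  · rw [← hi (fun i => if i ∈ J then -1 else 1) (fun i => by by_cases h : i ∈ J <;> simp [h])
      (WithLp.toLp 2 x)]
    congr 2
    funext i
    by_cases h : i ∈ J <;> simp [BlaschkeSantalo.flip, h]
  rcases Nat.eq_zero_or_pos n with rfl | hn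
  · refine uncond (by linarith) hp Φ hΦ fun J x => ?_
    congr 1
    exact Subsingleton.elim _ _
  rcases hc.eq_or_lt with rfl | hc'
  · have : Nonempty (Fin n) := ⟨⟨0, hn⟩⟩
    rw [BlaschkeSantalo.GeneralizedBS]
    simp [ENNReal.top_rpow_of_pos (show 0 < p by linarith)]
  -- Evenness is invariance under the single reflection in all coordinates.
  · refine BlaschkeSantalo.generalizedBS_of_lowerSemicontinuous (by linarith) hp
      (S := {Finset.univ}) (fun C F G hF hG hFi hGi h => ?_) hΦ ?_
    · exact BlaschkeSantalo.santalo_even hn.ne' hq hp hc' hF hG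
        (fun x => by rw [← BlaschkeSantalo.flip_univ]; exact hFi _ rfl x)
        (fun x => by rw [← BlaschkeSantalo.flip_univ]; exact hGi _ rfl x) h
    · rintro J rfl x
      rw [BlaschkeSantalo.flip_univ, WithLp.toLp_neg, he]
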